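/- Let $M$ be a smooth manifold of dimension $m=2p+2q+2$ with $p,q\ge 1$. Exterior derivatives of $1$-forms are normalized by $2\,d\alpha(X,Y)=X(\alpha(Y))-Y(\alpha(X))-\alpha([X,Y])$. A pair $(\alpha_1,\alpha_2)$ of smooth $1$-forms on $M$ is a contact pair of type $(p,q)$ if $\alpha_1\wedge(d\alpha_1)^p\wedge\alpha_2\wedge(d\alpha_2)^q$ vanishes nowhere, $(d\alpha_1)^{p+1}=0$ and $(d\alpha_2)^{q+1}=0$; its Reeb vector fields $Z_1,Z_2$ are determined by $\alpha_i(Z_j)=\delta_{ij}$ and $i_{Z_i}d\alpha_j=0$ for $i,j\in\{1,2\}$. A normal metric contact pair structure on $M$ consists of a contact pair $(\alpha_1,\alpha_2)$ of type $(p,q)$ with Reeb vector fields $Z_1,Z_2$, a smooth $(1,1)$-tensor field $\phi$ and a smooth Riemannian metric $g$ such that - $\phi^2=-I+\alpha_1\otimes Z_1+\alpha_2\otimes Z_2$ and $\phi Z_1=\phi Z_2=0$; - $\phi$ is decomposable, that is, it preserves $\ker\alpha_i\cap\ker d\alpha_i$ for $i=1,2$; - $g$ is associated, that is, $g(X,\phi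 Y)=(d\alpha_1+d\alpha_2)(X,Y)$ and $g(X,Z_i)=\alpha_i(X)$ for $i=1,2$; - the almost complex structures $J=\phi-\alpha_2\otimes Z_1+\alpha_1\otimes Z_2$ and $T=\phi+\alpha_2\otimes Z_1-\alpha_1\otimes Z_2$ are integrable (their Nijenhuis tensors vanish). Let $X^{\mathcal H}=X-\alpha_1(X)Z_1-\alpha_2(X)Z_2$ be the horizontal component of a vector $X$, and let $Ric$ be the Ricci tensor of $g$, where $Ric(X,Y)$ is the trace of $W\mapsto R(W,X)Y$ and $R(X,Y)=\nabla_X\nabla_Y-\nabla_Y\nabla_X-\nabla_{[X,Y]}$. Proposition. Let $M$ be a normal metric contact pair manifold as above. Then $M$ is generalized quasi-Einstein, that is, there are smooth functions $\lambda,\beta,\mu$ on $M$ with $$Ric(X,Y)=\lambda\, g(X,Y)+\beta\,\alpha_1(X)\alpha_1(Y)+\mu\,\alpha_2(X)\alpha_2(Y)\quad\text{for all } X,Y,$$ if and only if its horizontal bundle is Einstein, that is, there is a smooth function $\lambda$ on $M$ with $Ric(X^{\mathcal H},Y^{\mathcal H})=\lambda\, g(X^{\mathcal H},Y^{\mathcal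 H})$ for all $X,Y$. Moreover, whenever a function $\lambda$ on $M$ satisfies $Ric(X^{\mathcal H},Y^{\mathcal H})=\lambda\, g(X^{\mathcal H},Y^{\mathcal H})$ for all $X,Y$, then $$Ric=\lambda\, g+(2p-\lambda)\,\alpha_1\otimes\alpha_1+(2q-\lambda)\,\alpha_2\otimes\alpha_2 .$$ -/

import Mathlib

open Bundle VectorField Module
open scoped Manifold ContDiff

namespace ContactPair

section Metric

variable {E : Type*} [NormedAddCommGroup E] [NormedSpace ℝ E]
  {M : Type*} [TopologicalSpace M] [ChartedSpace E M] [IsManifold 𝓘(ℝ, E) ∞ M]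

/-- Smooth Riemannian metrics on `M`. -/
abbrev Metric (E : Type*) [NormedAddCommGroup E] [NormedSpace ℝ E]
    (M : Type*) [TopologicalSpace M] [ChartedSpace E M] [IsManifold 𝓘(ℝ, E) ∞ M] :=
  ContMDiffRiemannianMetric 𝓘(ℝ, E) ∞ E (fun x : M ↦ TangentSpace 𝓘(ℝ, E) x)

theorem mdifferentiableAt_metric (g : Metric E M)
    {X Y : Π x : M, TangentSpace 𝓘(ℝ, E) x} {x : M}
    (hX : MDiffAt (T% X) x) (hY : MDiffAt (T% Y) x) :
    MDiffAt (fun y ↦ g.inner y (X y) (Y y)) x := by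
  have : MDifferentiableAt 𝓘(ℝ, E) (𝓘(ℝ, E).prod 𝓘(ℝ))
      (fun m ↦ TotalSpace.mk' ℝ (E := Bundle.Trivial M ℝ) m (g.inner m (X m) (Y m))) x := by
    apply MDifferentiableAt.clm_bundle_apply₂ (F₁ := E) (F₂ := E)
    · exact (g.contMDiff x).mdifferentiableAt (by simp)
    · exact hX
    · exact hY
  simp only [mdifferentiableAt_totalSpace] at this
  exact this.2

/-- A smooth `1`-form on `M`. -/
structure OneForm (E : Type*) [NormedAddCommGroup E] [NormedSpace ℝ E]
    (M : Type*) [TopologicalSpace M] [ChartedSpace E M] [IsManifold 𝓘(ℝ, E) ∞ M] where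
  toFun : Π x : M, TangentSpace 𝓘(ℝ, E) x →L[ℝ] ℝ
  smooth : ContMDiff 𝓘(ℝ, E) (𝓘(ℝ, E).prod 𝓘(ℝ, E →L[ℝ] ℝ)) ∞
    (fun x ↦ TotalSpace.mk' (E →L[ℝ] ℝ) x (toFun x))

instance : CoeFun (OneForm E M) (fun _ ↦ Π x : M, TangentSpace 𝓘(ℝ, E) x →L[ℝ] ℝ) :=
  ⟨OneForm.toFun⟩

theorem OneForm.mdifferentiableAt (α : OneForm E M)
    {X : Π x : M, TangentSpace 𝓘(ℝ, E) x} {x : M} (hX : MDiffAt (T% X) x) :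
    MDiffAt (fun y ↦ α y (X y)) x := by
  have : MDifferentiableAt 𝓘(ℝ, E) (𝓘(ℝ, E).prod 𝓘(ℝ))
      (fun m ↦ TotalSpace.mk' ℝ (E := Bundle.Trivial M ℝ) m (α m (X m))) x := by
    apply MDifferentiableAt.clm_bundle_apply (F₁ := E)
    · exact (α.smooth x).mdifferentiableAt (by simp)
    · exact hX
  simp only [mdifferentiableAt_totalSpace] at this
  exact this.2

end Metric

section Tensors

set_option linter.unusedSectionVars false

variable {E : Type*} [NormedAddCommGroup E] [NormedSpace ℝ E] [FiniteDimensional ℝ E]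
  {M : Type*} [TopologicalSpace M] [ChartedSpace E M] [IsManifold 𝓘(ℝ, E) ∞ M]

instance finiteDimensional_tangentSpace (x : M) :
    FiniteDimensional ℝ (TangentSpace 𝓘(ℝ, E) x) :=
  inferInstanceAs (FiniteDimensional ℝ E)

/-! ### The exterior derivative of a one-form -/

/-- `dα(X, Y) = (X(α(Y)) - Y(α(X)) - α([X, Y])) / 2` on vector fields `X`, `Y`, at the point `x`.
The factor `1 / 2` is the usual convention of contact metric geometry. -/
noncomputable def OneForm.dAux (α : OneForm E M) (X Y : Π x : M, TangentSpace 𝓘(ℝ, E) x)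
    (x : M) : ℝ :=
  (1 / 2 : ℝ) * (mvfderiv 𝓘(ℝ, E) (fun y ↦ α y (Y y)) x (X x)
    - mvfderiv 𝓘(ℝ, E) (fun y ↦ α y (X y)) x (Y x) - α x (mlieBracket 𝓘(ℝ, E) X Y x))

theorem OneForm.dAux_tensorial_left (α : OneForm E M) {Y : Π x : M, TangentSpace 𝓘(ℝ, E) x}
    {x : M} : TensorialAt 𝓘(ℝ, E) E (fun X ↦ α.dAux X Y x) x where
  smul {f X} hf hX := by
    have h1 := mvfderiv_mul hf (α.mdifferentiableAt hX)
    simp only [Pi.mul_def] at h1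
    simp [OneForm.dAux, h1, mlieBracket_smul_left hf hX, Pi.smul_apply']
    ring
  add {X X'} hX hX' := by
    have h1 := mvfderiv_add (α.mdifferentiableAt hX) (α.mdifferentiableAt hX')
    simp only [Pi.add_def] at h1
    simp [OneForm.dAux, h1, mlieBracket_add_left hX hX']
    ring

theorem OneForm.dAux_swap (α : OneForm E M) (X Y : Π x : M, TangentSpace 𝓘(ℝ, E) x) (x : M) :
    α.dAux X Y x = - α.dAux Y X x := by
  simp only [OneForm.dAux, mlieBracket_swap_apply (V := X) (W := Y), map_neg]
  ring

theorem OneForm.dAux_tensorial_right (α : OneForm E M) {X : Π x : M, TangentSpace 𝓘(ℝ, E) x}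
    {x : M} : TensorialAt 𝓘(ℝ, E) E (fun Y ↦ α.dAux X Y x) x where
  smul {f Y} hf hY := by
    simp only [α.dAux_swap X]
    rw [α.dAux_tensorial_left.smul hf hY, smul_neg]
  add {Y Y'} hY hY' := by
    simp only [α.dAux_swap X]
    rw [α.dAux_tensorial_left.add hY hY', neg_add]

/-- The exterior derivative `dα` as a bilinear form on each tangent space, with the convention
`2 dα(X, Y) = X(α(Y)) - Y(α(X)) - α([X, Y])`. -/
noncomputable def OneForm.d (α : OneForm E M) (x : M) :
    TangentSpace 𝓘(ℝ, E) x →L[ℝ] TangentSpace 𝓘(ℝ, E) x →L[ℝ] ℝ :=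
  TensorialAt.mkHom₂ (fun X Y ↦ α.dAux X Y x) x (fun _ _ ↦ α.dAux_tensorial_left)
    (fun _ _ ↦ α.dAux_tensorial_right)

theorem OneForm.d_apply (α : OneForm E M) {X Y : Π x : M, TangentSpace 𝓘(ℝ, E) x} {x : M}
    (hX : MDiffAt (T% X) x) (hY : MDiffAt (T% Y) x) : α.d x (X x) (Y x) =
      (1 / 2 : ℝ) * (mvfderiv 𝓘(ℝ, E) (fun y ↦ α y (Y y)) x (X x)
        - mvfderiv 𝓘(ℝ, E) (fun y ↦ α y (X y)) x (Y x) - α x (mlieBracket 𝓘(ℝ, E) X Y x)) :=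
  TensorialAt.mkHom₂_apply _ _ hX hY

/-! ### The Levi-Civita connection -/

/-- The Koszul expression, which equals `g(∇_X Y, W)` for the Levi-Civita connection `∇`. -/
noncomputable def koszul (g : Metric E M) (X Y W : Π x : M, TangentSpace 𝓘(ℝ, E) x) (x : M) : ℝ :=
  (1 / 2 : ℝ) *
    (mvfderiv 𝓘(ℝ, E) (fun y ↦ g.inner y (Y y) (W y)) x (X x)
      + mvfderiv 𝓘(ℝ, E) (fun y ↦ g.inner y (X y) (W y)) x (Y x)
      - mvfderiv 𝓘(ℝ, E) (fun y ↦ g.inner y (X y) (Y y)) x (W x)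
      + g.inner x (mlieBracket 𝓘(ℝ, E) X Y x) (W x)
      - g.inner x (mlieBracket 𝓘(ℝ, E) X W x) (Y x)
      - g.inner x (mlieBracket 𝓘(ℝ, E) Y W x) (X x))

theorem koszul_tensorial_left (g : Metric E M) {Y W : Π x : M, TangentSpace 𝓘(ℝ, E) x} {x : M}
    (hY : MDiffAt (T% Y) x) (hW : MDiffAt (T% W) x) :
    TensorialAt 𝓘(ℝ, E) E (fun X ↦ koszul g X Y W x) x where
  smul {f X} hf hX := by
    have h1 := mvfderiv_mul hf (mdifferentiableAt_metric g hX hW)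
    have h2 := mvfderiv_mul hf (mdifferentiableAt_metric g hX hY)
    simp only [Pi.mul_def] at h1 h2
    simp [koszul, h1, h2, mlieBracket_smul_left hf hX, Pi.smul_apply']
    ring
  add {X X'} hX hX' := by
    have h1 := mvfderiv_add (mdifferentiableAt_metric g hX hW) (mdifferentiableAt_metric g hX' hW)
    have h2 := mvfderiv_add (mdifferentiableAt_metric g hX hY) (mdifferentiableAt_metric g hX' hY)
    simp only [Pi.add_def] at h1 h2
    simp [koszul, h1, h2, mlieBracket_add_left hX hX']
    ring

theorem koszul_tensorial_right (g : Metric E M) {X Y : Π x : M, TangentSpace 𝓘(ℝ, E) x} {x : M}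
    (hX : MDiffAt (T% X) x) (hY : MDiffAt (T% Y) x) :
    TensorialAt 𝓘(ℝ, E) E (fun W ↦ koszul g X Y W x) x where
  smul {f W} hf hW := by
    have h1 := mvfderiv_mul hf (mdifferentiableAt_metric g hY hW)
    have h2 := mvfderiv_mul hf (mdifferentiableAt_metric g hX hW)
    simp only [Pi.mul_def] at h1 h2
    simp [koszul, h1, h2, mlieBracket_smul_right hf hW, Pi.smul_apply']
    rw [g.symm x (W x) (Y x), g.symm x (W x) (X x)]
    ring
  add {W W'} hW hW' := by
    have h1 := mvfderiv_add (mdifferentiableAt_metric g hY hW) (mdifferentiableAt_metric g hY hW')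
    have h2 := mvfderiv_add (mdifferentiableAt_metric g hX hW) (mdifferentiableAt_metric g hX hW')
    simp only [Pi.add_def] at h1 h2
    simp [koszul, h1, h2, mlieBracket_add_right hW hW']
    ring

/-- The metric at `x` as a bilinear form. -/
noncomputable def metricForm (g : Metric E M) (x : M) :
    LinearMap.BilinForm ℝ (TangentSpace 𝓘(ℝ, E) x) :=
  LinearMap.mk₂ ℝ (fun u v ↦ g.inner x u v) (by simp) (by simp) (by simp) (by simp)

theorem metricForm_nondegenerate (g : Metric E M) (x : M) : (metricForm g x).Nondegenerate := by
  refine ⟨fun u hu ↦ ?_, fun u hu ↦ ?_⟩ <;>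
  · by_contra h
    exact (g.pos x u h).ne' (hu u)

open Classical in
/-- `u ↦ ∇_u Y` at `x`, determined by `g(∇_u Y, w) = koszul`, when `Y` is differentiable at `x`
(and `0` by convention otherwise). -/
noncomputable def leviCivitaAux (g : Metric E M) (Y : Π x : M, TangentSpace 𝓘(ℝ, E) x) (x : M) :
    TangentSpace 𝓘(ℝ, E) x →L[ℝ] TangentSpace 𝓘(ℝ, E) x :=
  have : T2Space (TangentSpace 𝓘(ℝ, E) x) := inferInstanceAs (T2Space E)
  if hY : MDiffAt (T% Y) x then
    LinearMap.toContinuousLinearMap <|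
      ((metricForm g x).toDual (metricForm_nondegenerate g x)).symm.toLinearMap ∘ₗ
        ContinuousLinearMap.coeLM ℝ ∘ₗ
          (TensorialAt.mkHom₂ (fun X W ↦ koszul g X Y W x) x
            (fun _ hW ↦ koszul_tensorial_left g hY hW)
            (fun _ hX ↦ koszul_tensorial_right g hX hY)).toLinearMap
  else 0

theorem inner_leviCivitaAux (g : Metric E M) {X Y W : Π x : M, TangentSpace 𝓘(ℝ, E) x} {x : M}
    (hX : MDiffAt (T% X) x) (hY : MDiffAt (T% Y) x) (hW : MDiffAt (T% W) x) :
    g.inner x (leviCivitaAux g Y x (X x)) (W x) = koszul g X Y W x := by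
  rw [← TensorialAt.mkHom₂_apply (Φ := fun X W ↦ koszul g X Y W x)
    (fun _ hW ↦ koszul_tensorial_left g hY hW) (fun _ hX ↦ koszul_tensorial_right g hX hY) hX hW]
  rw [leviCivitaAux, dif_pos hY]
  exact LinearMap.BilinForm.apply_toDual_symm_apply (hB := metricForm_nondegenerate g x) _ _

theorem metric_ext (g : Metric E M) {x : M} {u v : TangentSpace 𝓘(ℝ, E) x}
    (h : ∀ W : Π x : M, TangentSpace 𝓘(ℝ, E) x, MDiffAt (T% W) x →
      g.inner x u (W x) = g.inner x v (W x)) : u = v := by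
  by_contra hne
  have h1 := h (FiberBundle.extend E (u - v)) (FiberBundle.mdifferentiableAt_extend ..)
  simp only [FiberBundle.extend_apply_self] at h1
  have h2 := g.pos x (u - v) (sub_ne_zero.2 hne)
  simp only [map_sub, sub_apply] at h1 h2
  linarith

/-- The Levi-Civita connection of `g`: the value `∇_{X x} Y` at `x` is `leviCivita g Y x (X x)`. -/
noncomputable def leviCivita (g : Metric E M) :
    CovariantDerivative 𝓘(ℝ, E) E (fun x : M ↦ TangentSpace 𝓘(ℝ, E) x) where
  toFun := leviCivitaAux g
  isCovariantDerivativeOnUniv :=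
    { add := by
        intro Y Y' x hY hY' _
        ext u
        refine metric_ext g fun W hW ↦ ?_
        obtain ⟨X, hX, rfl⟩ : ∃ X : Π x : M, TangentSpace 𝓘(ℝ, E) x,
            MDiffAt (T% X) x ∧ X x = u :=
          ⟨FiberBundle.extend E u, FiberBundle.mdifferentiableAt_extend .., by simp⟩
        have h1 := mvfderiv_add (mdifferentiableAt_metric g hY hW) (mdifferentiableAt_metric g hY' hW)
        have h2 := mvfderiv_add (mdifferentiableAt_metric g hX hY) (mdifferentiableAt_metric g hX hY')
        simp only [Pi.add_def] at h1 h2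
        simp only [add_apply, map_add]
        rw [inner_leviCivitaAux g hX (mdifferentiableAt_add_section hY hY') hW,
          inner_leviCivitaAux g hX hY hW, inner_leviCivitaAux g hX hY' hW]
        simp [koszul, h1, h2, mlieBracket_add_left hY hY', mlieBracket_add_right hY hY']
        ring
      leibniz := by
        intro Y f x hY hf _
        ext u
        refine metric_ext g fun W hW ↦ ?_
        obtain ⟨X, hX, rfl⟩ : ∃ X : Π x : M, TangentSpace 𝓘(ℝ, E) x,
            MDiffAt (T% X) x ∧ X x = u :=
          ⟨FiberBundle.extend E u, FiberBundle.mdifferentiableAt_extend .., by simp⟩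
        have h1 := mvfderiv_mul hf (mdifferentiableAt_metric g hY hW)
        have h2 := mvfderiv_mul hf (mdifferentiableAt_metric g hX hY)
        simp only [Pi.mul_def] at h1 h2
        simp only [add_apply, map_add, smul_apply, map_smul,
          ContinuousLinearMap.smulRight_apply]
        rw [inner_leviCivitaAux g hX (hf.smul_section hY) hW, inner_leviCivitaAux g hX hY hW]
        simp [koszul, h1, h2, mlieBracket_smul_left hf hY, mlieBracket_smul_right hf hY,
          Pi.smul_apply']
        rw [g.symm x (Y x) (X x)]
        ring }

theorem inner_leviCivita (g : Metric E M) {X Y W : Π x : M, TangentSpace 𝓘(ℝ, E) x} {x : M}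
    (hX : MDiffAt (T% X) x) (hY : MDiffAt (T% Y) x) (hW : MDiffAt (T% W) x) :
    g.inner x (leviCivita g Y x (X x)) (W x) = koszul g X Y W x :=
  inner_leviCivitaAux g hX hY hW

theorem leviCivita_torsion_eq_zero (g : Metric E M) : (leviCivita g).torsion = 0 := by
  rw [CovariantDerivative.torsion_eq_zero_iff]
  intro X Y x hX hY
  refine metric_ext g fun W hW ↦ ?_
  simp only [map_sub, sub_apply]
  rw [inner_leviCivita g hX hY hW, inner_leviCivita g hY hX hW]
  simp only [koszul, mlieBracket_swap_apply (V := Y) (W := X), map_neg,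
    neg_apply, g.symm _ (Y _) (X _)]
  ring

theorem leviCivita_metric (g : Metric E M) {X Y W : Π x : M, TangentSpace 𝓘(ℝ, E) x} {x : M}
    (hX : MDiffAt (T% X) x) (hY : MDiffAt (T% Y) x) (hW : MDiffAt (T% W) x) :
    mvfderiv 𝓘(ℝ, E) (fun y ↦ g.inner y (Y y) (W y)) x (X x) =
      g.inner x (leviCivita g Y x (X x)) (W x) + g.inner x (Y x) (leviCivita g W x (X x)) := by
  rw [g.symm x (Y x), inner_leviCivita g hX hY hW, inner_leviCivita g hX hW hY]
  simp only [koszul, mlieBracket_swap_apply (V := W) (W := Y), map_neg,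
    neg_apply, g.symm _ (W _) (Y _)]
  ring

/-- The vector field `∇_X Y`. -/
noncomputable def nabla (g : Metric E M) (X Y : Π x : M, TangentSpace 𝓘(ℝ, E) x) :
    Π x : M, TangentSpace 𝓘(ℝ, E) x :=
  fun x ↦ leviCivita g Y x (X x)

/-! ### Curvature -/

/-- The Riemann curvature `R(X, Y)W = ∇_X ∇_Y W - ∇_Y ∇_X W - ∇_{[X, Y]} W` on vector fields. -/
noncomputable def curvature (g : Metric E M) (X Y W : Π x : M, TangentSpace 𝓘(ℝ, E) x) :
    Π x : M, TangentSpace 𝓘(ℝ, E) x :=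
  nabla g X (nabla g Y W) - nabla g Y (nabla g X W) - nabla g (mlieBracket 𝓘(ℝ, E) X Y) W

/-- The Ricci curvature: `Ric(u, v)` is the trace of `w ↦ R(w, u)v` on the tangent space at `x`,
computed in a basis; tangent vectors are extended to vector fields that are smooth near `x`
(the value of `R` at `x` does not depend on the extensions). -/
noncomputable def ricci (g : Metric E M) (x : M) (u v : TangentSpace 𝓘(ℝ, E) x) : ℝ :=
  ∑ i, (finBasis ℝ (TangentSpace 𝓘(ℝ, E) x)).coord i
    (curvature g (FiberBundle.extend E (finBasis ℝ (TangentSpace 𝓘(ℝ, E) x) i))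
      (FiberBundle.extend E u) (FiberBundle.extend E v) x)

/-! ### The exterior algebra of the cotangent space -/

/-- A covector at `x` as an element of `Λ T*_x M`. -/
noncomputable def extOne {x : M} (a : TangentSpace 𝓘(ℝ, E) x →L[ℝ] ℝ) :
    ExteriorAlgebra ℝ (Dual ℝ (TangentSpace 𝓘(ℝ, E) x)) :=
  ExteriorAlgebra.ι ℝ (a : TangentSpace 𝓘(ℝ, E) x →ₗ[ℝ] ℝ)

/-- An alternating bilinear form `B` at `x` as the element `(1 / 2) ∑ B(eᵢ, eⱼ) eⁱ ∧ eʲ` of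
`Λ T*_x M`, for a basis `e` with dual basis `eⁱ`. -/
noncomputable def extTwo {x : M}
    (B : TangentSpace 𝓘(ℝ, E) x →L[ℝ] TangentSpace 𝓘(ℝ, E) x →L[ℝ] ℝ) :
    ExteriorAlgebra ℝ (Dual ℝ (TangentSpace 𝓘(ℝ, E) x)) :=
  (1 / 2 : ℝ) • ∑ i, ∑ j,
    B (finBasis ℝ (TangentSpace 𝓘(ℝ, E) x) i) (finBasis ℝ (TangentSpace 𝓘(ℝ, E) x) j) •
      (ExteriorAlgebra.ι ℝ ((finBasis ℝ (TangentSpace 𝓘(ℝ, E) x)).coord i) *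
        ExteriorAlgebra.ι ℝ ((finBasis ℝ (TangentSpace 𝓘(ℝ, E) x)).coord j))

/-! ### Contact pairs -/

/-- `(α₁, α₂)` is a contact pair of type `(p, q)`, with `p`, `q` positive, on a manifold of
dimension `2p + 2q + 2`. -/
structure IsContactPair (p q : ℕ) (α₁ α₂ : OneForm E M) : Prop where
  p_pos : 0 < p
  q_pos : 0 < q
  dim : finrank ℝ E = 2 * p + 2 * q + 2
  /-- `α₁ ∧ (dα₁)^p ∧ α₂ ∧ (dα₂)^q` vanishes nowhere. -/
  volume : ∀ x, extOne (α₁ x) * extTwo (α₁.d x) ^ p * extOne (α₂ x) * extTwo (α₂.d x) ^ q ≠ 0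
  pow₁ : ∀ x, extTwo (α₁.d x) ^ (p + 1) = 0
  pow₂ : ∀ x, extTwo (α₂.d x) ^ (q + 1) = 0

/-- `Z₁, Z₂` are the Reeb vector fields of the pair `(α₁, α₂)`. -/
structure IsReebPair (α₁ α₂ : OneForm E M) (Z₁ Z₂ : Π x : M, TangentSpace 𝓘(ℝ, E) x) : Prop where
  smooth₁ : CMDiff ∞ (T% Z₁)
  smooth₂ : CMDiff ∞ (T% Z₂)
  apply₁₁ : ∀ x, α₁ x (Z₁ x) = 1
  apply₂₂ : ∀ x, α₂ x (Z₂ x) = 1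
  apply₁₂ : ∀ x, α₁ x (Z₂ x) = 0
  apply₂₁ : ∀ x, α₂ x (Z₁ x) = 0
  contract₁₁ : ∀ x, α₁.d x (Z₁ x) = 0
  contract₂₁ : ∀ x, α₂.d x (Z₁ x) = 0
  contract₁₂ : ∀ x, α₁.d x (Z₂ x) = 0
  contract₂₂ : ∀ x, α₂.d x (Z₂ x) = 0

/-- A smooth field of endomorphisms (a `(1, 1)`-tensor field) on `M`. -/
structure EndField (E : Type*) [NormedAddCommGroup E] [NormedSpace ℝ E]
    (M : Type*) [TopologicalSpace M] [ChartedSpace E M] [IsManifold 𝓘(ℝ, E) ∞ M] where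
  toFun : Π x : M, TangentSpace 𝓘(ℝ, E) x →L[ℝ] TangentSpace 𝓘(ℝ, E) x
  smooth : ContMDiff 𝓘(ℝ, E) (𝓘(ℝ, E).prod 𝓘(ℝ, E →L[ℝ] E)) ∞
    (fun x ↦ TotalSpace.mk' (E →L[ℝ] E)
      (E := fun x : M ↦ TangentSpace 𝓘(ℝ, E) x →L[ℝ] TangentSpace 𝓘(ℝ, E) x) x (toFun x))

/-- The vanishing of the Nijenhuis tensor
`[X, Y] + J[JX, Y] + J[X, JY] - [JX, JY]` of a field of endomorphisms `J`; for an almost complex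
structure `J` this is integrability. The condition at `x` is tested on vector fields that are smooth
at `x`. -/
def IsIntegrable (J : Π x : M, TangentSpace 𝓘(ℝ, E) x →L[ℝ] TangentSpace 𝓘(ℝ, E) x) : Prop :=
  ∀ (x : M) (X Y : Π x : M, TangentSpace 𝓘(ℝ, E) x),
    CMDiffAt ∞ (T% X) x → CMDiffAt ∞ (T% Y) x →
    mlieBracket 𝓘(ℝ, E) X Y x
      + J x (mlieBracket 𝓘(ℝ, E) (fun y ↦ J y (X y)) Y x)
      + J x (mlieBracket 𝓘(ℝ, E) X (fun y ↦ J y (Y y)) x)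
      - mlieBracket 𝓘(ℝ, E) (fun y ↦ J y (X y)) (fun y ↦ J y (Y y)) x = 0

/-- An almost contact pair structure `(α₁, α₂, φ)` of type `(p, q)` on `M`, together with its
Reeb vector fields `Z₁, Z₂`. -/
structure AlmostContactPair (E : Type*) [NormedAddCommGroup E] [NormedSpace ℝ E]
    [FiniteDimensional ℝ E] (M : Type*) [TopologicalSpace M] [ChartedSpace E M]
    [IsManifold 𝓘(ℝ, E) ∞ M] (p q : ℕ) where
  α₁ : OneForm E M
  α₂ : OneForm E M
  Z₁ : Π x : M, TangentSpace 𝓘(ℝ, E) x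
  Z₂ : Π x : M, TangentSpace 𝓘(ℝ, E) x
  φ : EndField E M
  contact : IsContactPair p q α₁ α₂
  reeb : IsReebPair α₁ α₂ Z₁ Z₂
  φ_sq : ∀ (x : M) (v : TangentSpace 𝓘(ℝ, E) x),
    φ.toFun x (φ.toFun x v) = -v + α₁ x v • Z₁ x + α₂ x v • Z₂ x
  φ_Z₁ : ∀ x, φ.toFun x (Z₁ x) = 0
  φ_Z₂ : ∀ x, φ.toFun x (Z₂ x) = 0

namespace AlmostContactPair

variable {p q : ℕ} (S : AlmostContactPair E M p q)

/-- `φ` preserves the tangent bundles `TFᵢ = ker αᵢ ∩ ker dαᵢ` of the characteristic foliations. -/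
def IsDecomposable : Prop :=
  ∀ (x : M) (v : TangentSpace 𝓘(ℝ, E) x),
    (S.α₁ x v = 0 ∧ S.α₁.d x v = 0 →
      S.α₁ x (S.φ.toFun x v) = 0 ∧ S.α₁.d x (S.φ.toFun x v) = 0) ∧
    (S.α₂ x v = 0 ∧ S.α₂.d x v = 0 →
      S.α₂ x (S.φ.toFun x v) = 0 ∧ S.α₂.d x (S.φ.toFun x v) = 0)

/-- The metric `g` is associated with the almost contact pair structure. -/
structure IsAssociated (g : Metric E M) : Prop where
  apply_φ : ∀ (x : M) (u v : TangentSpace 𝓘(ℝ, E) x),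
    g.inner x u (S.φ.toFun x v) = S.α₁.d x u v + S.α₂.d x u v
  apply_Z₁ : ∀ (x : M) (u : TangentSpace 𝓘(ℝ, E) x), g.inner x u (S.Z₁ x) = S.α₁ x u
  apply_Z₂ : ∀ (x : M) (u : TangentSpace 𝓘(ℝ, E) x), g.inner x u (S.Z₂ x) = S.α₂ x u

/-- The almost complex structure `J = φ - α₂ ⊗ Z₁ + α₁ ⊗ Z₂`. -/
noncomputable def J (x : M) : TangentSpace 𝓘(ℝ, E) x →L[ℝ] TangentSpace 𝓘(ℝ, E) x :=
  S.φ.toFun x - (S.α₂ x).smulRight (S.Z₁ x) + (S.α₁ x).smulRight (S.Z₂ x)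

/-- The almost complex structure `T = φ + α₂ ⊗ Z₁ - α₁ ⊗ Z₂`. -/
noncomputable def T (x : M) : TangentSpace 𝓘(ℝ, E) x →L[ℝ] TangentSpace 𝓘(ℝ, E) x :=
  S.φ.toFun x + (S.α₂ x).smulRight (S.Z₁ x) - (S.α₁ x).smulRight (S.Z₂ x)

/-- Normality: the almost complex structures `J` and `T` are integrable. -/
def IsNormal : Prop := IsIntegrable S.J ∧ IsIntegrable S.T

/-- `(M, φ, Z₁, Z₂, α₁, α₂, g)` is a normal metric contact pair manifold
(with decomposable `φ`). -/
structure IsNormalMetricContactPair (g : Metric E M) : Prop where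
  decomposable : S.IsDecomposable
  associated : S.IsAssociated g
  normal : S.IsNormal

/-- The horizontal component of a tangent vector, with respect to the splitting of the tangent bundle
into `ker α₁ ∩ ker α₂` and the span of `Z₁, Z₂`. -/
noncomputable def horizontal (x : M) (v : TangentSpace 𝓘(ℝ, E) x) : TangentSpace 𝓘(ℝ, E) x :=
  v - S.α₁ x v • S.Z₁ x - S.α₂ x v • S.Z₂ x

/-- `Ric(X, Y) = lam g(X, Y) + β α₁(X) α₁(Y) + μ α₂(X) α₂(Y)` for all `X`, `Y`. -/
def RicciForm (g : Metric E M) (lam β μ : M → ℝ) : Prop :=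
  ∀ (x : M) (u v : TangentSpace 𝓘(ℝ, E) x),
    ricci g x u v = lam x * g.inner x u v + β x * (S.α₁ x u * S.α₁ x v)
      + μ x * (S.α₂ x u * S.α₂ x v)

/-- The manifold is generalized quasi-Einstein. -/
def IsGeneralizedQuasiEinstein (g : Metric E M) : Prop :=
  ∃ lam β μ : M → ℝ, CMDiff ∞ lam ∧ CMDiff ∞ β ∧ CMDiff ∞ μ ∧ S.RicciForm g lam β μ

/-- `Ric(X^H, Y^H) = lam g(X^H, Y^H)` for all `X`, `Y`. -/
def HorizontalRicciForm (g : Metric E M) (lam : M → ℝ) : Prop :=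
  ∀ (x : M) (u v : TangentSpace 𝓘(ℝ, E) x),
    ricci g x (S.horizontal x u) (S.horizontal x v) =
      lam x * g.inner x (S.horizontal x u) (S.horizontal x v)

/-- The horizontal bundle is Einstein. -/
def IsHorizontalEinstein (g : Metric E M) : Prop :=
  ∃ lam : M → ℝ, CMDiff ∞ lam ∧ S.HorizontalRicciForm g lam

end AlmostContactPair

end Tensors

end ContactPair

/-! The Ricci tensor of a normal metric contact pair is computed in the Reeb directions:
`Ric(u, Z₁) = 2p α₁(u)` and `Ric(u, Z₂) = 2q α₂(u)`. Together with the symmetry of `Ric` this gives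
`Ric(u, v) = Ric(uᴴ, vᴴ) + 2p α₁(u) α₁(v) + 2q α₂(u) α₂(v)`, from which both directions of the
equivalence and the explicit form of `Ric` are immediate (`ricci_eq`). By the symmetry of the two
indices (`AlmostContactPair.swap`) only `Z₁` has to be considered.

Integrability of `J` and of `T`, evaluated on `Z₁` and a second field, shows that `φ` is invariant
under the flow of `Z₁`; as `dα₁ + dα₂` is invariant too, `Z₁` is Killing, and `A = ∇Z₁` is the
skew endomorphism with `g(A u, w) = dα₁(u, w)` (`killing`, `inner_nabla_Z₁`). Since `φ` is
decomposable, `A` vanishes on the first characteristic foliation and is `-φ` on the second; hence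
`A φ = φ A`, and `φ A = -A²` is a projection. Its trace is `2p`: the condition `(dα₁)^(p + 1) = 0`
bounds the rank of `dα₁` by `2p` (`finrank_range_le_of_twoForm_pow_eq_zero`), and likewise for
`dα₂`, and the dimension of the manifold leaves no room for smaller ranks.

For a Killing field, `Ric(u, Z₁)` is the trace of `w ↦ (∇_w A) u` (`ricci_Z₁_eq_trace`). For `u = Z₁`
this is the trace of `-A²`, and for `u = Z₂` it is the trace of `-A ∇Z₂ = 0`. For horizontal `u` the
trace vanishes. Indeed `φ` is parallel as far as horizontal vectors are concerned, as for a Kähler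
structure (`inner_covEnd_φ_eq_zero`). As `dα₁` is closed, twice the trace of `w ↦ φ ((∇_w A) u)` is
the trace of `φ ∘ ∇_u A`, which is that of `∇_u (φ A)`, the derivative of a field of projections, so
it is zero. Differentiating `φ A = A φ` then gives the vanishing of the trace of
`w ↦ (∇_w A) (φ u)`, and every horizontal vector has the form `φ u`.

Identities between tensors are checked at a point on extensions of tangent vectors whose covariant
derivative vanishes there (`exists_normal_extension`). -/

namespace ContactPair

set_option linter.unusedSectionVars false

/-! ### Smoothness of derivatives, brackets and covariant derivatives -/

section Smoothness

variable {E : Type*} [NormedAddCommGroup E] [NormedSpace ℝ E] [FiniteDimensional ℝ E]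
  {M : Type*} [TopologicalSpace M] [ChartedSpace E M] [IsManifold 𝓘(ℝ, E) ∞ M]
  {x : M} {X Y W : Π x : M, TangentSpace 𝓘(ℝ, E) x}

theorem mdiffAt_of_smooth (hX : CMDiffAt ∞ (T% X) x) : MDiffAt (T% X) x :=
  hX.mdifferentiableAt (by simp)

theorem eventually_mdiffAt_of_smooth (hX : CMDiffAt ∞ (T% X) x) :
    ∀ᶠ y in nhds x, MDiffAt (T% X) y := by
  have h1 : CMDiffAt 1 (T% X) x := hX.of_le (by exact_mod_cast le_top)
  have : IsManifold (𝓘(ℝ, E).prod 𝓘(ℝ, E)) 1 (TotalSpace E (fun x : M ↦ TangentSpace 𝓘(ℝ, E) x)) :=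
    inferInstance
  rw [contMDiffAt_iff_contMDiffAt_nhds (by simp)] at h1
  exact h1.mono fun y hy ↦ hy.mdifferentiableAt (by simp)

theorem smooth_extend (v : TangentSpace 𝓘(ℝ, E) x) :
    CMDiffAt ∞ (T% (FiberBundle.extend E v : Π x : M, TangentSpace 𝓘(ℝ, E) x)) x :=
  FiberBundle.contMDiffAt_extend ..

theorem smooth_metric (g : Metric E M) (hX : CMDiffAt ∞ (T% X) x) (hY : CMDiffAt ∞ (T% Y) x) :
    CMDiffAt ∞ (fun y ↦ g.inner y (X y) (Y y)) x := by
  have : ContMDiffAt 𝓘(ℝ, E) (𝓘(ℝ, E).prod 𝓘(ℝ)) ∞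
      (fun m ↦ TotalSpace.mk' ℝ (E := Bundle.Trivial M ℝ) m (g.inner m (X m) (Y m))) x := by
    apply ContMDiffAt.clm_bundle_apply₂ (F₁ := E) (F₂ := E)
    · exact g.contMDiff x
    · exact hX
    · exact hY
  simp only [contMDiffAt_totalSpace] at this
  exact this.2

theorem OneForm.smooth_apply (α : OneForm E M) (hX : CMDiffAt ∞ (T% X) x) :
    CMDiffAt ∞ (fun y ↦ α y (X y)) x := by
  have : ContMDiffAt 𝓘(ℝ, E) (𝓘(ℝ, E).prod 𝓘(ℝ)) ∞
      (fun m ↦ TotalSpace.mk' ℝ (E := Bundle.Trivial M ℝ) m (α m (X m))) x := by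
    apply ContMDiffAt.clm_bundle_apply (F₁ := E)
    · exact α.smooth x
    · exact hX
  simp only [contMDiffAt_totalSpace] at this
  exact this.2

theorem EndField.smooth_apply (φ : EndField E M) (hX : CMDiffAt ∞ (T% X) x) :
    CMDiffAt ∞ (T% (fun y ↦ φ.toFun y (X y))) x := by
  apply ContMDiffAt.clm_bundle_apply (F₁ := E)
    (E₁ := fun x : M ↦ TangentSpace 𝓘(ℝ, E) x) (E₂ := fun x : M ↦ TangentSpace 𝓘(ℝ, E) x)
  · exact φ.smooth x
  · exact hX

theorem minSmoothness_le_infty {n : ℕ} : minSmoothness ℝ n ≤ ∞ := by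
  rw [minSmoothness_of_isRCLikeNormedField]
  exact_mod_cast le_top

theorem smooth_mlieBracket (hX : CMDiffAt ∞ (T% X) x) (hY : CMDiffAt ∞ (T% Y) x) :
    CMDiffAt ∞ (T% (mlieBracket 𝓘(ℝ, E) X Y)) x := by
  have : IsManifold 𝓘(ℝ, E) (((⊤ : ℕ∞) : WithTop ℕ∞) + 1) M := by simpa
  have h2 : IsManifold 𝓘(ℝ, E) (minSmoothness ℝ 2) M :=
    IsManifold.of_le (n := ∞) minSmoothness_le_infty
  refine ContMDiffAt.mlieBracket_vectorField (n := ⊤) (m := ⊤) hX hY ?_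
  simp [minSmoothness_of_isRCLikeNormedField]

theorem smooth_mvfderiv {f : M → ℝ} (hf : CMDiffAt ∞ f x) (hX : CMDiffAt ∞ (T% X) x) :
    CMDiffAt ∞ (fun y ↦ mvfderiv 𝓘(ℝ, E) f y (X y)) x := by
  have h := hf.mfderiv_const (m := ∞) (by simp)
  have h2 := ContMDiffAt.clm_apply_of_inCoordinates
    (b₁ := id) (b₂ := f) (E₁ := fun x : M ↦ TangentSpace 𝓘(ℝ, E) x)
    (E₂ := fun x : ℝ ↦ TangentSpace 𝓘(ℝ, ℝ) x) (v := X) h hX hf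
  rw [contMDiffAt_totalSpace] at h2
  simpa [mvfderiv] using! h2.2

theorem mvfderiv_smooth_sub {f h : M → ℝ} (hf : CMDiffAt ∞ f x) (hh : CMDiffAt ∞ h x) :
    mvfderiv 𝓘(ℝ, E) (fun y ↦ f y - h y) x = mvfderiv 𝓘(ℝ, E) f x - mvfderiv 𝓘(ℝ, E) h x :=
  mvfderiv_sub (hf.mdifferentiableAt (by simp)) (hh.mdifferentiableAt (by simp))

theorem mvfderiv_congr {f h : M → ℝ} (hf : f =ᶠ[nhds x] h) :
    mvfderiv 𝓘(ℝ, E) f x = mvfderiv 𝓘(ℝ, E) h x := by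
  unfold mvfderiv
  rw [hf.mfderiv_eq, hf.self_of_nhds]

theorem mlieBracket_congr {X' Y' : Π x : M, TangentSpace 𝓘(ℝ, E) x}
    (hX : X =ᶠ[nhds x] X') (hY : Y =ᶠ[nhds x] Y') :
    mlieBracket 𝓘(ℝ, E) X Y x = mlieBracket 𝓘(ℝ, E) X' Y' x :=
  hX.mlieBracket_vectorField_eq hY

theorem leibniz_mlieBracket_smooth (hX : CMDiffAt ∞ (T% X) x) (hY : CMDiffAt ∞ (T% Y) x)
    (hW : CMDiffAt ∞ (T% W) x) :
    mlieBracket 𝓘(ℝ, E) X (mlieBracket 𝓘(ℝ, E) Y W) x =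
      mlieBracket 𝓘(ℝ, E) (mlieBracket 𝓘(ℝ, E) X Y) W x
        + mlieBracket 𝓘(ℝ, E) Y (mlieBracket 𝓘(ℝ, E) X W) x := by
  have h3 : IsManifold 𝓘(ℝ, E) (minSmoothness ℝ 3) M :=
    IsManifold.of_le (n := ∞) minSmoothness_le_infty
  have h : minSmoothness ℝ 2 ≤ ∞ := minSmoothness_le_infty
  exact leibniz_identity_mlieBracket_apply (hX.of_le h) (hY.of_le h) (hW.of_le h)

/-- `X(Y f) - Y(X f) = [X, Y] f`. It follows from the Jacobi identity for `X`, `Y` and `f • W`. -/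
theorem mvfderiv_commutator {f : M → ℝ} (hf : CMDiffAt ∞ f x) (hX : CMDiffAt ∞ (T% X) x)
    (hY : CMDiffAt ∞ (T% Y) x) :
    mvfderiv 𝓘(ℝ, E) (fun y ↦ mvfderiv 𝓘(ℝ, E) f y (Y y)) x (X x)
      - mvfderiv 𝓘(ℝ, E) (fun y ↦ mvfderiv 𝓘(ℝ, E) f y (X y)) x (Y x)
      = mvfderiv 𝓘(ℝ, E) f x (mlieBracket 𝓘(ℝ, E) X Y x) := by
  rcases subsingleton_or_nontrivial (TangentSpace 𝓘(ℝ, E) x) with hT | hT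
  · rw [Subsingleton.elim (X x) 0, Subsingleton.elim (Y x) 0,
      Subsingleton.elim (mlieBracket 𝓘(ℝ, E) X Y x) 0]
    simp
  obtain ⟨w, hw⟩ := exists_ne (0 : TangentSpace 𝓘(ℝ, E) x)
  set W : Π x : M, TangentSpace 𝓘(ℝ, E) x := FiberBundle.extend E w with hWdef
  have hW : CMDiffAt ∞ (T% W) x := smooth_extend w
  have key : ∀ {Z : Π x : M, TangentSpace 𝓘(ℝ, E) x}, CMDiffAt ∞ (T% Z) x →
      mlieBracket 𝓘(ℝ, E) Z (f • W) =ᶠ[nhds x]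
        (fun y ↦ mvfderiv 𝓘(ℝ, E) f y (Z y)) • W + f • mlieBracket 𝓘(ℝ, E) Z W := by
    intro Z hZ
    have hf1 : CMDiffAt 1 f x := hf.of_le (by exact_mod_cast le_top)
    rw [contMDiffAt_iff_contMDiffAt_nhds (by simp)] at hf1
    filter_upwards [hf1, eventually_mdiffAt_of_smooth hW] with y h1 h2
    rw [mlieBracket_smul_right (h1.mdifferentiableAt (by simp)) h2]
    rfl
  have second : ∀ {Z Z' : Π x : M, TangentSpace 𝓘(ℝ, E) x}, CMDiffAt ∞ (T% Z) x →
      CMDiffAt ∞ (T% Z') x →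
      mlieBracket 𝓘(ℝ, E) Z (mlieBracket 𝓘(ℝ, E) Z' (f • W)) x =
        mvfderiv 𝓘(ℝ, E) (fun y ↦ mvfderiv 𝓘(ℝ, E) f y (Z' y)) x (Z x) • W x
        + mvfderiv 𝓘(ℝ, E) f x (Z' x) • mlieBracket 𝓘(ℝ, E) Z W x
        + (mvfderiv 𝓘(ℝ, E) f x (Z x) • mlieBracket 𝓘(ℝ, E) Z' W x
        + f x • mlieBracket 𝓘(ℝ, E) Z (mlieBracket 𝓘(ℝ, E) Z' W) x) := by
    intro Z Z' hZ hZ'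
    have hd := smooth_mvfderiv hf hZ'
    have hb := smooth_mlieBracket hZ' hW
    rw [mlieBracket_congr (Filter.EventuallyEq.refl _ Z) (key hZ'),
      mlieBracket_add_right (mdiffAt_of_smooth (hd.smul_section hW))
        (mdiffAt_of_smooth (hf.smul_section hb)),
      mlieBracket_smul_right (hd.mdifferentiableAt (by simp)) (mdiffAt_of_smooth hW),
      mlieBracket_smul_right (hf.mdifferentiableAt (by simp)) (mdiffAt_of_smooth hb)]
  have hj := leibniz_mlieBracket_smooth hX hY (hf.smul_section hW)
  have hj' := leibniz_mlieBracket_smooth hX hY hW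
  rw [second hX hY, second hY hX, (key (smooth_mlieBracket hX hY)).self_of_nhds] at hj
  simp only [Pi.add_apply, Pi.smul_apply', hj'] at hj
  have hW' : W x = w := by simp [hWdef]
  have h0 : (mvfderiv 𝓘(ℝ, E) (fun y ↦ mvfderiv 𝓘(ℝ, E) f y (Y y)) x (X x)
      - mvfderiv 𝓘(ℝ, E) (fun y ↦ mvfderiv 𝓘(ℝ, E) f y (X y)) x (Y x)
      - mvfderiv 𝓘(ℝ, E) f x (mlieBracket 𝓘(ℝ, E) X Y x)) • w = 0 := by
    rw [← hW', sub_smul, sub_smul, ← sub_eq_zero.2 hj]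
    module
  rcases smul_eq_zero.1 h0 with h | h
  · linarith
  · exact absurd h hw

/-- A vector field is smooth as soon as its inner products with smooth vector fields are: its
coefficients in a local frame are obtained by inverting the Gram matrix of the frame. -/
theorem smooth_of_inner (g : Metric E M) (X : Π x : M, TangentSpace 𝓘(ℝ, E) x) (x : M)
    (h : ∀ W : Π x : M, TangentSpace 𝓘(ℝ, E) x, CMDiffAt ∞ (T% W) x →
      CMDiffAt ∞ (fun y ↦ g.inner y (X y) (W y)) x) : CMDiffAt ∞ (T% X) x := by
  set t := trivializationAt E (fun x : M ↦ TangentSpace 𝓘(ℝ, E) x) x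
  have hx : x ∈ t.baseSet := FiberBundle.mem_baseSet_trivializationAt' x
  set b := finBasis ℝ E
  set ι := Fin (finrank ℝ E)
  set e : ι → Π x : M, TangentSpace 𝓘(ℝ, E) x := t.localFrame b
  have he : ∀ i, CMDiffAt ∞ (T% (e i)) x := fun i ↦
    contMDiffAt_localFrame_of_mem ∞ _ b i hx
  set c : ι → M → ℝ := fun i y ↦ t.localFrameCoeff 𝓘(ℝ, E) b i y (X y) with hc
  rw [contMDiffAt_iff_localFrameCoeff b hx (e := t)]
  let U : ι → ι → (ι → ℝ) →L[ℝ] (ι → ℝ) := fun i j ↦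
    (ContinuousLinearMap.proj j).smulRight (Pi.single i 1)
  let G : M → (ι → ℝ) →L[ℝ] (ι → ℝ) := fun y ↦
    ∑ i, ∑ j, g.inner y (e j y) (e i y) • U i j
  have hGa : ∀ y v i, G y v i = ∑ j, g.inner y (e j y) (e i y) * v j := by
    intro y v i
    simp [G, U, Finset.sum_apply, Pi.single_apply]
  have hG : CMDiffAt ∞ G x :=
    contMDiffAt_finsetSum fun i _ ↦ contMDiffAt_finsetSum fun j _ ↦
      (smooth_metric g (he j) (he i)).smul contMDiffAt_const
  have hinv : ∀ y ∈ t.baseSet, (G y).IsInvertible := by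
    intro y hy
    have hinj : Function.Injective (G y).toLinearMap := by
      rw [← LinearMap.ker_eq_bot, LinearMap.ker_eq_bot']
      intro v hv
      have hei : ∀ i, e i y = t.basisAt b hy i := fun i ↦ by simp [e, hy]
      have h1 : ∀ i, g.inner y (∑ j, v j • e j y) (e i y) = 0 := by
        intro i
        have := congrFun hv i
        rw [ContinuousLinearMap.coe_coe, hGa] at this
        simpa [mul_comm] using this
      have h2 : ∑ j, v j • e j y = 0 := by
        by_contra hne
        refine (g.pos y _ hne).ne' ?_
        rw [map_sum]
        exact Finset.sum_eq_zero fun i _ ↦ by rw [map_smul, h1, smul_zero]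
      ext i
      refine Fintype.linearIndependent_iff.1 (t.basisAt b hy).linearIndependent v ?_ i
      simpa [hei] using h2
    refine ⟨(LinearEquiv.ofInjectiveEndo (G y).toLinearMap hinj).toContinuousLinearEquiv, ?_⟩
    ext1 v
    rfl
  have hs : ContMDiffAt 𝓘(ℝ, E) 𝓘(ℝ, ι → ℝ) ∞ (fun y i ↦ g.inner y (X y) (e i y)) x := by
    rw [contMDiffAt_pi_space]
    exact fun i ↦ h _ (he i)
  have hfin : ContMDiffAt 𝓘(ℝ, E) 𝓘(ℝ, ι → ℝ) ∞
      (fun y ↦ (G y).inverse (fun i ↦ g.inner y (X y) (e i y))) x :=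
    ContMDiffAt.clm_apply ((hinv x hx).contDiffAt_map_inverse.contMDiffAt.comp x hG) hs
  intro i
  rw [contMDiffAt_pi_space] at hfin
  refine (hfin i).congr_of_eventuallyEq ?_
  filter_upwards [t.open_baseSet.mem_nhds hx] with y hyt
  have : G y (fun i ↦ c i y) = fun i ↦ g.inner y (X y) (e i y) := by
    ext i
    rw [hGa]
    conv_rhs => rw [t.eq_sum_localFrameCoeff_smul (I := 𝓘(ℝ, E)) (b := b) (s := X) hyt]
    simp [c, e, mul_comm]
  rw [← this, (hinv y hyt).inverse_apply_self]
  rfl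

theorem smooth_koszul (g : Metric E M) (hX : CMDiffAt ∞ (T% X) x) (hY : CMDiffAt ∞ (T% Y) x)
    (hW : CMDiffAt ∞ (T% W) x) : CMDiffAt ∞ (fun y ↦ koszul g X Y W y) x := by
  unfold koszul
  have h1 := smooth_mvfderiv (smooth_metric g hY hW) hX
  have h2 := smooth_mvfderiv (smooth_metric g hX hW) hY
  have h3 := smooth_mvfderiv (smooth_metric g hX hY) hW
  have h4 := smooth_metric g (smooth_mlieBracket hX hY) hW
  have h5 := smooth_metric g (smooth_mlieBracket hX hW) hY
  have h6 := smooth_metric g (smooth_mlieBracket hY hW) hX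
  exact contMDiffAt_const.mul (((((h1.add h2).sub h3).add h4).sub h5).sub h6)

theorem smooth_nabla (g : Metric E M) (hX : CMDiffAt ∞ (T% X) x) (hY : CMDiffAt ∞ (T% Y) x) :
    CMDiffAt ∞ (T% (nabla g X Y)) x := by
  refine smooth_of_inner g _ x fun W hW ↦ ?_
  refine (smooth_koszul g hX hY hW).congr_of_eventuallyEq ?_
  filter_upwards [eventually_mdiffAt_of_smooth hX, eventually_mdiffAt_of_smooth hY,
    eventually_mdiffAt_of_smooth hW] with y h1 h2 h3
  exact inner_leviCivita g h1 h2 h3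

end Smoothness

/-! ### Operations on smooth vector fields that are tensorial at a point -/

section Tensorial

variable {E : Type*} [NormedAddCommGroup E] [NormedSpace ℝ E] [FiniteDimensional ℝ E]
  {M : Type*} [TopologicalSpace M] [ChartedSpace E M] [IsManifold 𝓘(ℝ, E) ∞ M]
  {A : Type*} [AddCommGroup A] [Module ℝ A]
  {Φ : (Π x : M, TangentSpace 𝓘(ℝ, E) x) → A} {x : M}

/-- An operation on vector fields which is additive and homogeneous over functions, when restricted
to vector fields and functions that are smooth at `x`. In contrast with `TensorialAt`, nothing is
required for vector fields that are merely differentiable, so that operations of second order, such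
as the curvature, are covered. -/
structure SmoothTensorialAt (Φ : (Π x : M, TangentSpace 𝓘(ℝ, E) x) → A) (x : M) : Prop where
  smul : ∀ {f : M → ℝ} {X : Π x : M, TangentSpace 𝓘(ℝ, E) x}, CMDiffAt ∞ f x →
    CMDiffAt ∞ (T% X) x → Φ (f • X) = f x • Φ X
  add : ∀ {X Y : Π x : M, TangentSpace 𝓘(ℝ, E) x}, CMDiffAt ∞ (T% X) x → CMDiffAt ∞ (T% Y) x →
    Φ (X + Y) = Φ X + Φ Y

namespace SmoothTensorialAt

/-- The indicator of the set where `X` and `Y` agree is smooth at `x`: no bump function is needed. -/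
theorem congr_eventually (hΦ : SmoothTensorialAt Φ x) {X Y : Π x : M, TangentSpace 𝓘(ℝ, E) x}
    (hX : CMDiffAt ∞ (T% X) x) (hY : CMDiffAt ∞ (T% Y) x) (h : ∀ᶠ y in nhds x, X y = Y y) :
    Φ X = Φ Y := by
  classical
  let ψ (y : M) : ℝ := if X y = Y y then 1 else 0
  have hψx : ψ x = 1 := by simp [ψ, h.self_of_nhds]
  have hψ' : ψ • X = ψ • Y := by
    funext y
    by_cases hy : X y = Y y <;> simp [ψ, hy]
  have hψ : CMDiffAt ∞ ψ x := by
    have : CMDiffAt ∞ (fun (_ : M) ↦ (1 : ℝ)) x := contMDiffAt_const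
    exact this.congr_of_eventuallyEq (h.mono fun y hy ↦ by simp [ψ, hy])
  calc Φ X = Φ (ψ • X) := by simp [hΦ.smul hψ hX, hψx]
    _ = Φ (ψ • Y) := by rw [hψ']
    _ = Φ Y := by simp [hΦ.smul hψ hY, hψx]

theorem zero (hΦ : SmoothTensorialAt Φ x) : Φ 0 = 0 := by
  have h : CMDiffAt ∞ (T% (0 : Π x : M, TangentSpace 𝓘(ℝ, E) x)) x :=
    contMDiff_zeroSection ℝ _ x
  simpa using hΦ.add h h

theorem sum (hΦ : SmoothTensorialAt Φ x) {ι : Type*} {s : Finset ι}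
    (X : ι → Π x : M, TangentSpace 𝓘(ℝ, E) x) (hX : ∀ i ∈ s, CMDiffAt ∞ (T% (X i)) x) :
    Φ (fun y ↦ ∑ i ∈ s, X i y) = ∑ i ∈ s, Φ (X i) := by
  classical
  induction s using Finset.induction_on with
  | empty => exact hΦ.zero
  | insert a s ha h =>
      simp only [Finset.mem_insert, forall_eq_or_imp] at hX
      simp only [Finset.sum_insert ha, ← h hX.2]
      exact hΦ.add hX.1 (.sum_section hX.2)

theorem pointwise (hΦ : SmoothTensorialAt Φ x) {X Y : Π x : M, TangentSpace 𝓘(ℝ, E) x}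
    (hX : CMDiffAt ∞ (T% X) x) (hY : CMDiffAt ∞ (T% Y) x) (h : X x = Y x) : Φ X = Φ Y := by
  set t := trivializationAt E (fun x : M ↦ TangentSpace 𝓘(ℝ, E) x) x
  have hx : x ∈ t.baseSet := FiberBundle.mem_baseSet_trivializationAt' x
  set b := finBasis ℝ E
  set e := t.localFrame b
  set c := t.localFrameCoeff 𝓘(ℝ, E) b
  have he : ∀ i, CMDiffAt ∞ (T% (e i)) x := fun i ↦ contMDiffAt_localFrame_of_mem ∞ _ b i hx
  have hc : ∀ {Z : Π x : M, TangentSpace 𝓘(ℝ, E) x}, CMDiffAt ∞ (T% Z) x → ∀ i,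
      CMDiffAt ∞ (LinearMap.piApply (c i) Z) x := fun hZ i ↦ contMDiffAt_localFrameCoeff b hx hZ i
  have key : ∀ {Z : Π x : M, TangentSpace 𝓘(ℝ, E) x}, CMDiffAt ∞ (T% Z) x →
      Φ Z = ∑ i, c i x (Z x) • Φ (e i) := by
    intro Z hZ
    have h1 : ∀ i ∈ Finset.univ, CMDiffAt ∞ (T% (LinearMap.piApply (c i) Z • e i)) x :=
      fun i _ ↦ (hc hZ i).smul_section (he i)
    rw [hΦ.congr_eventually hZ (.sum_section h1)
      (t.eventually_eq_localFrame_sum_coeff_smul b hx), hΦ.sum _ h1]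
    exact Finset.sum_congr rfl fun i _ ↦ hΦ.smul (hc hZ i) (he i)
  rw [key hX, key hY, h]

/-- The linear map on the tangent space at `x` given by an operation that is tensorial at `x`. -/
noncomputable def toLinearMap (hΦ : SmoothTensorialAt Φ x) : TangentSpace 𝓘(ℝ, E) x →ₗ[ℝ] A where
  toFun v := Φ (FiberBundle.extend E v)
  map_add' v w := by
    rw [← hΦ.add (smooth_extend v) (smooth_extend w)]
    exact hΦ.pointwise (smooth_extend _) ((smooth_extend v).add_section (smooth_extend w))
      (by simp)
  map_smul' c v := by
    rw [RingHom.id_apply, ← hΦ.smul (f := fun _ ↦ c) contMDiffAt_const (smooth_extend v)]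
    exact hΦ.pointwise (smooth_extend _) (contMDiffAt_const.smul_section (smooth_extend v))
      (by simp)

theorem toLinearMap_apply (hΦ : SmoothTensorialAt Φ x) {X : Π x : M, TangentSpace 𝓘(ℝ, E) x}
    (hX : CMDiffAt ∞ (T% X) x) : hΦ.toLinearMap (X x) = Φ X :=
  hΦ.pointwise (smooth_extend _) hX (by simp)

end SmoothTensorialAt

end Tensorial

/-! ### Covariant derivatives of vector fields and of endomorphism fields -/

section Covariant

variable {E : Type*} [NormedAddCommGroup E] [NormedSpace ℝ E] [FiniteDimensional ℝ E]
  {M : Type*} [TopologicalSpace M] [ChartedSpace E M] [IsManifold 𝓘(ℝ, E) ∞ M]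
  (g : Metric E M) {x : M} {X Y W V : Π x : M, TangentSpace 𝓘(ℝ, E) x}

theorem leviCivita_add (hX : CMDiffAt ∞ (T% X) x) (hY : CMDiffAt ∞ (T% Y) x) :
    leviCivita g (X + Y) x = leviCivita g X x + leviCivita g Y x :=
  (leviCivita g).isCovariantDerivativeOnUniv.add (mdiffAt_of_smooth hX) (mdiffAt_of_smooth hY)

theorem leviCivita_smul {f : M → ℝ} (hf : CMDiffAt ∞ f x) (hX : CMDiffAt ∞ (T% X) x) :
    leviCivita g (f • X) x =
      f x • leviCivita g X x + (mvfderiv 𝓘(ℝ, E) f x).smulRight (X x) :=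
  (leviCivita g).isCovariantDerivativeOnUniv.leibniz (mdiffAt_of_smooth hX)
    (hf.mdifferentiableAt (by simp))

theorem smooth_congr (hX : CMDiffAt ∞ (T% X) x) (h : Y =ᶠ[nhds x] X) : CMDiffAt ∞ (T% Y) x :=
  hX.congr_of_eventuallyEq (h.mono fun y hy ↦ by simp [hy])

theorem leviCivita_congr (hX : CMDiffAt ∞ (T% X) x) (h : Y =ᶠ[nhds x] X) :
    leviCivita g Y x = leviCivita g X x :=
  (leviCivita g).isCovariantDerivativeOnUniv.congr_of_eventuallyEq
    (mdiffAt_of_smooth (smooth_congr hX h)) (mdiffAt_of_smooth hX) Filter.univ_mem h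

theorem leviCivita_neg (hX : CMDiffAt ∞ (T% X) x) : leviCivita g (-X) x = -leviCivita g X x := by
  have := (leviCivita g).isCovariantDerivativeOnUniv.smul_const (-1) (mdiffAt_of_smooth hX)
  simpa using this

theorem leviCivita_sub (hX : CMDiffAt ∞ (T% X) x) (hY : CMDiffAt ∞ (T% Y) x) :
    leviCivita g (X - Y) x = leviCivita g X x - leviCivita g Y x := by
  rw [sub_eq_add_neg, leviCivita_add g hX hY.neg_section, leviCivita_neg g hY, sub_eq_add_neg]

theorem mlieBracket_eq (hX : CMDiffAt ∞ (T% X) x) (hY : CMDiffAt ∞ (T% Y) x) :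
    mlieBracket 𝓘(ℝ, E) X Y x = nabla g X Y x - nabla g Y X x :=
  (((CovariantDerivative.torsion_eq_zero_iff _).1 (leviCivita_torsion_eq_zero g))
    (mdiffAt_of_smooth hX) (mdiffAt_of_smooth hY)).symm

theorem mvfderiv_inner (v : TangentSpace 𝓘(ℝ, E) x) (hY : CMDiffAt ∞ (T% Y) x)
    (hW : CMDiffAt ∞ (T% W) x) :
    mvfderiv 𝓘(ℝ, E) (fun y ↦ g.inner y (Y y) (W y)) x v =
      g.inner x (leviCivita g Y x v) (W x) + g.inner x (Y x) (leviCivita g W x v) := by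
  have := leviCivita_metric g (mdiffAt_of_smooth (smooth_extend v)) (mdiffAt_of_smooth hY)
    (mdiffAt_of_smooth hW)
  simpa using this

theorem inner_ext {u v : TangentSpace 𝓘(ℝ, E) x} (h : ∀ w, g.inner x u w = g.inner x v w) :
    u = v :=
  metric_ext g fun W _ ↦ h (W x)

/-- Every tangent vector at `x` extends to a vector field that is smooth near `x` and whose covariant
derivative vanishes at `x`. -/
theorem exists_normal_extension (v : TangentSpace 𝓘(ℝ, E) x) :
    ∃ X : Π x : M, TangentSpace 𝓘(ℝ, E) x,
      CMDiffAt ∞ (T% X) x ∧ X x = v ∧ leviCivita g X x = 0 := by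
  set b := finBasis ℝ (TangentSpace 𝓘(ℝ, E) x)
  set X₀ : Π x : M, TangentSpace 𝓘(ℝ, E) x := FiberBundle.extend E v
  have hT2 : T2Space (TangentSpace 𝓘(ℝ, E) x) := inferInstanceAs (T2Space E)
  -- `l i` is minus the `i`-th component of `∇ X₀` at `x`
  let l : Fin (finrank ℝ (TangentSpace 𝓘(ℝ, E) x)) →
      TangentSpace 𝓘(ℝ, E) x →L[ℝ] ℝ := fun i ↦
    -((LinearMap.toContinuousLinearMap (b.coord i)) ∘L leviCivita g X₀ x)
  let l' : Fin (finrank ℝ (TangentSpace 𝓘(ℝ, E) x)) → E →L[ℝ] ℝ := l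
  let f : Fin (finrank ℝ (TangentSpace 𝓘(ℝ, E) x)) → M → ℝ := fun i y ↦
    l' i (extChartAt 𝓘(ℝ, E) x y) - l' i (extChartAt 𝓘(ℝ, E) x x)
  have hf : ∀ i, CMDiffAt ∞ (f i) x := fun i ↦
    (((l' i).contMDiff.contMDiffAt).comp x contMDiffAt_extChartAt).sub contMDiffAt_const
  have hfx : ∀ i, f i x = 0 := fun i ↦ by simp [f]
  have hdf : ∀ i, mvfderiv 𝓘(ℝ, E) (f i) x = l i := by
    intro i
    have h1 : HasMFDerivAt 𝓘(ℝ, E) 𝓘(ℝ, ℝ) (fun y ↦ l' i (extChartAt 𝓘(ℝ, E) x y)) x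
        ((l' i) ∘L mfderiv 𝓘(ℝ, E) 𝓘(ℝ, E) (extChartAt 𝓘(ℝ, E) x) x) :=
      HasMFDerivAt.comp x (l' i).hasMFDerivAt
        (mdifferentiableAt_extChartAt (mem_chart_source E x)).hasMFDerivAt
    have h2 : mvfderiv 𝓘(ℝ, E) (fun y ↦ l' i (extChartAt 𝓘(ℝ, E) x y)) x = l i := by
      unfold mvfderiv
      rw [h1.mfderiv, mfderiv_extChartAt_self]
      rfl
    have h3 := mvfderiv_sub (I := 𝓘(ℝ, E)) h1.mdifferentiableAt
      (mdifferentiableAt_const (c := l' i (extChartAt 𝓘(ℝ, E) x x)))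
    rw [h2, mvfderiv_const, sub_zero] at h3
    exact h3
  let e : Fin (finrank ℝ (TangentSpace 𝓘(ℝ, E) x)) → Π x : M, TangentSpace 𝓘(ℝ, E) x :=
    fun i ↦ FiberBundle.extend E (b i)
  have he : ∀ i, CMDiffAt ∞ (T% (e i)) x := fun i ↦ smooth_extend _
  have hcov : ∀ s : Finset (Fin (finrank ℝ (TangentSpace 𝓘(ℝ, E) x))),
      CMDiffAt ∞ (T% (∑ i ∈ s, f i • e i)) x ∧
      leviCivita g (∑ i ∈ s, f i • e i) x = ∑ i ∈ s, (l i).smulRight (b i) := by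
    intro s
    classical
    induction s using Finset.induction_on with
    | empty => exact ⟨contMDiff_zeroSection ℝ _ x, by simp⟩
    | insert a s ha h =>
        rw [Finset.sum_insert ha, Finset.sum_insert ha, ← h.2]
        refine ⟨((hf a).smul_section (he a)).add_section h.1, ?_⟩
        rw [leviCivita_add g ((hf a).smul_section (he a)) h.1, leviCivita_smul g (hf a) (he a), hfx,
          hdf]
        simp only [e, FiberBundle.extend_apply_self, zero_smul, zero_add]
  refine ⟨X₀ + ∑ i, f i • e i, (smooth_extend v).add_section (hcov _).1, ?_, ?_⟩
  · simp [X₀, hfx]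
  · rw [leviCivita_add g (smooth_extend v) (hcov _).1, (hcov _).2]
    ext w
    simp [l, X₀]

/-- A field of endomorphisms that maps smooth vector fields to smooth vector fields. -/
def IsSmoothEnd (B : Π x : M, TangentSpace 𝓘(ℝ, E) x →L[ℝ] TangentSpace 𝓘(ℝ, E) x) : Prop :=
  ∀ ⦃x : M⦄ ⦃X : Π x : M, TangentSpace 𝓘(ℝ, E) x⦄, CMDiffAt ∞ (T% X) x →
    CMDiffAt ∞ (T% (fun y ↦ B y (X y))) x

variable {B : Π x : M, TangentSpace 𝓘(ℝ, E) x →L[ℝ] TangentSpace 𝓘(ℝ, E) x}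

theorem covEnd_tensorial (hB : IsSmoothEnd B) (x : M) :
    SmoothTensorialAt (fun X ↦ (leviCivita g (fun y ↦ B y (X y)) x - B x ∘L leviCivita g X x :
      TangentSpace 𝓘(ℝ, E) x →L[ℝ] TangentSpace 𝓘(ℝ, E) x)) x where
  smul {f X} hf hX := by
    have h : (fun y ↦ B y ((f • X) y)) = f • fun y ↦ B y (X y) := by
      funext y; simp
    rw [h, leviCivita_smul g hf (hB hX), leviCivita_smul g hf hX]
    ext v
    simp
    module
  add {X Y} hX hY := by
    have h : (fun y ↦ B y ((X + Y) y)) = (fun y ↦ B y (X y)) + fun y ↦ B y (Y y) := by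
      funext y; simp
    rw [h, leviCivita_add g (hB hX) (hB hY), leviCivita_add g hX hY]
    ext v
    simp
    module

/-- The covariant derivative of a field of endomorphisms, with the argument of the endomorphism
first: `covEnd g hB x u w` is `(∇_w B) u`. -/
noncomputable def covEnd (hB : IsSmoothEnd B) (x : M) :
    TangentSpace 𝓘(ℝ, E) x →ₗ[ℝ] TangentSpace 𝓘(ℝ, E) x →ₗ[ℝ] TangentSpace 𝓘(ℝ, E) x :=
  ContinuousLinearMap.coeLM ℝ ∘ₗ (covEnd_tensorial g hB x).toLinearMap

theorem covEnd_apply (hB : IsSmoothEnd B) (hX : CMDiffAt ∞ (T% X) x)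
    (w : TangentSpace 𝓘(ℝ, E) x) :
    covEnd g hB x (X x) w = leviCivita g (fun y ↦ B y (X y)) x w - B x (leviCivita g X x w) := by
  have := (covEnd_tensorial g hB x).toLinearMap_apply hX
  simp [covEnd, this]

end Covariant

/-! ### Symmetries of the curvature and of the Ricci tensor -/

section Curvature

variable {E : Type*} [NormedAddCommGroup E] [NormedSpace ℝ E] [FiniteDimensional ℝ E]
  {M : Type*} [TopologicalSpace M] [ChartedSpace E M] [IsManifold 𝓘(ℝ, E) ∞ M]
  (g : Metric E M) {x : M} {X Y W V X' Y' W' : Π x : M, TangentSpace 𝓘(ℝ, E) x}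

theorem nabla_congr (hX : X =ᶠ[nhds x] X') (hY : CMDiffAt ∞ (T% Y) x)
    (h : Y' =ᶠ[nhds x] Y) : nabla g X Y' x = nabla g X' Y x := by
  simp only [nabla, leviCivita_congr g hY h, hX.self_of_nhds]

theorem eventually_leviCivita_smul {f : M → ℝ} (hf : CMDiffAt ∞ f x) (hX : CMDiffAt ∞ (T% X) x) :
    nabla g Y (f • X) =ᶠ[nhds x]
      f • nabla g Y X + (fun y ↦ mvfderiv 𝓘(ℝ, E) f y (Y y)) • X := by
  have hf1 : CMDiffAt 1 f x := hf.of_le (by exact_mod_cast le_top)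
  rw [contMDiffAt_iff_contMDiffAt_nhds (by simp)] at hf1
  filter_upwards [hf1, eventually_mdiffAt_of_smooth hX] with y h1 h2
  simp [nabla, (leviCivita g).isCovariantDerivativeOnUniv.leibniz h2
    (h1.mdifferentiableAt (by simp))]
  rfl

theorem eventually_leviCivita_add (hX : CMDiffAt ∞ (T% X) x) (hW : CMDiffAt ∞ (T% W) x) :
    nabla g Y (X + W) =ᶠ[nhds x] nabla g Y X + nabla g Y W := by
  filter_upwards [eventually_mdiffAt_of_smooth hX, eventually_mdiffAt_of_smooth hW] with y h1 h2
  simp [nabla, (leviCivita g).isCovariantDerivativeOnUniv.add h1 h2]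
  rfl

theorem curvature_swap : curvature g X Y W x = -curvature g Y X W x := by
  simp only [curvature, Pi.sub_apply]
  rw [show nabla g (mlieBracket 𝓘(ℝ, E) X Y) W x = -nabla g (mlieBracket 𝓘(ℝ, E) Y X) W x by
    simp [nabla, mlieBracket_swap_apply (V := X) (W := Y)]]
  abel

theorem curvature_tensorial_fst (hW : CMDiffAt ∞ (T% W) x) :
    SmoothTensorialAt (fun X ↦ curvature g X Y W x) x where
  smul {f X} hf hX := by
    have h1 : nabla g Y (nabla g (f • X) W) x =
        f x • nabla g Y (nabla g X W) x + mvfderiv 𝓘(ℝ, E) f x (Y x) • nabla g X W x := by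
      have h : nabla g (f • X) W = f • nabla g X W := by funext y; simp [nabla]
      rw [h, (eventually_leviCivita_smul g hf (smooth_nabla g hX hW)).self_of_nhds]
      simp
    simp only [curvature, Pi.sub_apply]
    rw [h1]
    simp only [nabla, mlieBracket_smul_left (hf.mdifferentiableAt (by simp)) (mdiffAt_of_smooth hX)]
    simp
    module
  add {X X'} hX hX' := by
    have h1 : nabla g Y (nabla g (X + X') W) x =
        nabla g Y (nabla g X W) x + nabla g Y (nabla g X' W) x := by
      have h : nabla g (X + X') W = nabla g X W + nabla g X' W := by funext y; simp [nabla]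
      rw [h, (eventually_leviCivita_add g (smooth_nabla g hX hW)
        (smooth_nabla g hX' hW)).self_of_nhds]
      simp
    simp only [curvature, Pi.sub_apply]
    rw [h1]
    simp only [nabla, mlieBracket_add_left (mdiffAt_of_smooth hX) (mdiffAt_of_smooth hX')]
    simp
    abel

theorem curvature_tensorial_snd (hW : CMDiffAt ∞ (T% W) x) :
    SmoothTensorialAt (fun Y ↦ curvature g X Y W x) x where
  smul {f Y} hf hY := by
    rw [curvature_swap g (X := X), curvature_swap g (X := X),
      (curvature_tensorial_fst g hW).smul hf hY, smul_neg]
  add {Y Y'} hY hY' := by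
    simp only [curvature_swap g (X := X)]
    rw [(curvature_tensorial_fst g hW).add hY hY', neg_add]

theorem curvature_tensorial_trd (hX : CMDiffAt ∞ (T% X) x) (hY : CMDiffAt ∞ (T% Y) x) :
    SmoothTensorialAt (fun W ↦ curvature g X Y W x) x where
  smul {f W} hf hW := by
    have h1 : ∀ {X Y : Π x : M, TangentSpace 𝓘(ℝ, E) x}, CMDiffAt ∞ (T% X) x →
        CMDiffAt ∞ (T% Y) x → nabla g X (nabla g Y (f • W)) x =
        f x • nabla g X (nabla g Y W) x + mvfderiv 𝓘(ℝ, E) f x (X x) • nabla g Y W x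
        + (mvfderiv 𝓘(ℝ, E) f x (Y x) • nabla g X W x
        + mvfderiv 𝓘(ℝ, E) (fun y ↦ mvfderiv 𝓘(ℝ, E) f y (Y y)) x (X x) • W x) := by
      intro X Y hX hY
      have h2 := hf.smul_section (smooth_nabla g hY hW)
      have h3 := (smooth_mvfderiv hf hY).smul_section hW
      rw [nabla_congr g (Filter.EventuallyEq.refl _ X) (h2.add_section h3)
        (eventually_leviCivita_smul g hf hW),
        (eventually_leviCivita_add g h2 h3).self_of_nhds, Pi.add_apply,
        (eventually_leviCivita_smul g hf (smooth_nabla g hY hW)).self_of_nhds,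
        (eventually_leviCivita_smul g (smooth_mvfderiv hf hY) hW).self_of_nhds]
      simp
    have h4 := mvfderiv_commutator hf hX hY
    simp only [curvature, Pi.sub_apply]
    rw [h1 hX hY, h1 hY hX, (eventually_leviCivita_smul g hf hW).self_of_nhds]
    simp only [Pi.add_apply, Pi.smul_apply', ← h4]
    module
  add {W W'} hW hW' := by
    have h1 : ∀ {X Y : Π x : M, TangentSpace 𝓘(ℝ, E) x}, CMDiffAt ∞ (T% X) x →
        CMDiffAt ∞ (T% Y) x → nabla g X (nabla g Y (W + W')) x =
        nabla g X (nabla g Y W) x + nabla g X (nabla g Y W') x := by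
      intro X Y hX hY
      have h2 := smooth_nabla g hY hW
      have h3 := smooth_nabla g hY hW'
      rw [nabla_congr g (Filter.EventuallyEq.refl _ X) (h2.add_section h3)
        (eventually_leviCivita_add g hW hW'), (eventually_leviCivita_add g h2 h3).self_of_nhds]
      simp
    simp only [curvature, Pi.sub_apply]
    rw [h1 hX hY, h1 hY hX, (eventually_leviCivita_add g hW hW').self_of_nhds]
    simp
    abel

theorem curvature_pointwise (hX : CMDiffAt ∞ (T% X) x) (hY : CMDiffAt ∞ (T% Y) x)
    (hW : CMDiffAt ∞ (T% W) x) (hX' : CMDiffAt ∞ (T% X') x) (hY' : CMDiffAt ∞ (T% Y') x)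
    (hW' : CMDiffAt ∞ (T% W') x) (h1 : X x = X' x) (h2 : Y x = Y' x) (h3 : W x = W' x) :
    curvature g X Y W x = curvature g X' Y' W' x := by
  rw [(curvature_tensorial_fst g hW).pointwise hX hX' h1,
    (curvature_tensorial_snd g hW).pointwise hY hY' h2,
    (curvature_tensorial_trd g hX' hY').pointwise hW hW' h3]

theorem curvature_bianchi (hX : CMDiffAt ∞ (T% X) x) (hY : CMDiffAt ∞ (T% Y) x)
    (hW : CMDiffAt ∞ (T% W) x) :
    curvature g X Y W x + curvature g Y W X x + curvature g W X Y x = 0 := by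
  have key : ∀ {X Y W : Π x : M, TangentSpace 𝓘(ℝ, E) x}, CMDiffAt ∞ (T% X) x →
      CMDiffAt ∞ (T% Y) x → CMDiffAt ∞ (T% W) x →
      nabla g X (nabla g Y W) x - nabla g X (nabla g W Y) x
        - nabla g (mlieBracket 𝓘(ℝ, E) Y W) X x =
      mlieBracket 𝓘(ℝ, E) X (mlieBracket 𝓘(ℝ, E) Y W) x := by
    intro X Y W hX hY hW
    rw [mlieBracket_eq g hX (smooth_mlieBracket hY hW)]
    have h : mlieBracket 𝓘(ℝ, E) Y W =ᶠ[nhds x] nabla g Y W - nabla g W Y := by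
      filter_upwards [eventually_mdiffAt_of_smooth hY, eventually_mdiffAt_of_smooth hW]
        with y h1 h2
      exact (((CovariantDerivative.torsion_eq_zero_iff _).1 (leviCivita_torsion_eq_zero g))
        h1 h2).symm
    have h2 : nabla g X (mlieBracket 𝓘(ℝ, E) Y W) x =
        nabla g X (nabla g Y W) x - nabla g X (nabla g W Y) x := by
      rw [nabla_congr g (Filter.EventuallyEq.refl _ X)
        ((smooth_nabla g hY hW).sub_section (smooth_nabla g hW hY)) h]
      simp [nabla, leviCivita_sub g (smooth_nabla g hY hW) (smooth_nabla g hW hY)]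
    rw [h2]
  have k1 := key hX hY hW
  have k2 := key hY hW hX
  have k3 := key hW hX hY
  have hj := leibniz_mlieBracket_smooth hX hY hW
  have e1 : mlieBracket 𝓘(ℝ, E) (mlieBracket 𝓘(ℝ, E) X Y) W x =
      -mlieBracket 𝓘(ℝ, E) W (mlieBracket 𝓘(ℝ, E) X Y) x := mlieBracket_swap_apply
  have e2 : mlieBracket 𝓘(ℝ, E) Y (mlieBracket 𝓘(ℝ, E) X W) x =
      -mlieBracket 𝓘(ℝ, E) Y (mlieBracket 𝓘(ℝ, E) W X) x := by
    rw [mlieBracket_swap (V := X) (W := W)]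
    have := mlieBracket_const_smul_right (I := 𝓘(ℝ, E)) (V := Y) (c := (-1 : ℝ))
      (mdiffAt_of_smooth (smooth_mlieBracket hW hX))
    simpa using this
  rw [e1, e2, ← k1, ← k2, ← k3] at hj
  simp only [curvature, Pi.sub_apply]
  rw [← sub_eq_zero] at hj
  rw [← hj]
  abel

theorem curvature_skew (hX : CMDiffAt ∞ (T% X) x) (hY : CMDiffAt ∞ (T% Y) x)
    (hW : CMDiffAt ∞ (T% W) x) (hV : CMDiffAt ∞ (T% V) x) :
    g.inner x (curvature g X Y W x) (V x) = -g.inner x (W x) (curvature g X Y V x) := by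
  have key : ∀ {X Y : Π x : M, TangentSpace 𝓘(ℝ, E) x}, CMDiffAt ∞ (T% X) x →
      CMDiffAt ∞ (T% Y) x →
      mvfderiv 𝓘(ℝ, E) (fun z ↦ mvfderiv 𝓘(ℝ, E) (fun y ↦ g.inner y (W y) (V y)) z (Y z)) x (X x)
      = g.inner x (nabla g X (nabla g Y W) x) (V x) + g.inner x (nabla g Y W x) (nabla g X V x)
      + (g.inner x (nabla g X W x) (nabla g Y V x)
        + g.inner x (W x) (nabla g X (nabla g Y V) x)) := by
    intro X Y hX hY
    have h : (fun z ↦ mvfderiv 𝓘(ℝ, E) (fun y ↦ g.inner y (W y) (V y)) z (Y z)) =ᶠ[nhds x]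
        fun z ↦ g.inner z (nabla g Y W z) (V z) + g.inner z (W z) (nabla g Y V z) := by
      filter_upwards [eventually_mdiffAt_of_smooth hY, eventually_mdiffAt_of_smooth hW,
        eventually_mdiffAt_of_smooth hV] with y h1 h2 h3
      exact leviCivita_metric g h1 h2 h3
    have s1 := smooth_metric g (smooth_nabla g hY hW) hV
    have s2 := smooth_metric g hW (smooth_nabla g hY hV)
    have h5 := mvfderiv_add (I := 𝓘(ℝ, E)) (s1.mdifferentiableAt (by simp))
      (s2.mdifferentiableAt (by simp))
    simp only [Pi.add_def] at h5
    rw [mvfderiv_congr h, h5, add_apply, mvfderiv_inner g _ (smooth_nabla g hY hW) hV,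
      mvfderiv_inner g _ hW (smooth_nabla g hY hV)]
    rfl
  have hc := mvfderiv_commutator (smooth_metric g hW hV) hX hY
  rw [key hX hY, key hY hX, mvfderiv_inner g _ hW hV] at hc
  simp only [curvature, Pi.sub_apply, map_sub, sub_apply]
  simp only [nabla] at hc ⊢
  linarith

/-- The curvature `R(u, v)w` of tangent vectors at `x`. -/
noncomputable def riem (x : M) (u v w : TangentSpace 𝓘(ℝ, E) x) : TangentSpace 𝓘(ℝ, E) x :=
  curvature g (FiberBundle.extend E u) (FiberBundle.extend E v) (FiberBundle.extend E w) x

theorem riem_apply (hX : CMDiffAt ∞ (T% X) x) (hY : CMDiffAt ∞ (T% Y) x)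
    (hW : CMDiffAt ∞ (T% W) x) : riem g x (X x) (Y x) (W x) = curvature g X Y W x :=
  curvature_pointwise g (smooth_extend _) (smooth_extend _) (smooth_extend _) hX hY hW
    (by simp) (by simp) (by simp)

theorem riem_swap (u v w : TangentSpace 𝓘(ℝ, E) x) : riem g x u v w = -riem g x v u w :=
  curvature_swap g

theorem riem_bianchi (u v w : TangentSpace 𝓘(ℝ, E) x) :
    riem g x u v w + riem g x v w u + riem g x w u v = 0 :=
  curvature_bianchi g (smooth_extend _) (smooth_extend _) (smooth_extend _)

theorem riem_skew (u v w z : TangentSpace 𝓘(ℝ, E) x) :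
    g.inner x (riem g x u v w) z = -g.inner x (riem g x u v z) w := by
  have := curvature_skew g (smooth_extend u) (smooth_extend v) (smooth_extend w) (smooth_extend z)
  rw [g.symm x _ w]
  simpa [riem] using this

/-- Pair symmetry follows from the first Bianchi identity for the four triples among `u, v, w, z`. -/
theorem riem_pair_symm (u v w z : TangentSpace 𝓘(ℝ, E) x) :
    g.inner x (riem g x u v w) z = g.inner x (riem g x w z u) v := by
  have sw : ∀ a b c d : TangentSpace 𝓘(ℝ, E) x,
      g.inner x (riem g x a b c) d = -g.inner x (riem g x b a c) d := fun a b c d ↦ by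
    rw [riem_swap]; simp
  have bi : ∀ a b c d : TangentSpace 𝓘(ℝ, E) x, g.inner x (riem g x a b c) d
      + g.inner x (riem g x b c a) d + g.inner x (riem g x c a b) d = 0 := fun a b c d ↦ by
    have := congrArg (fun t ↦ g.inner x t d) (riem_bianchi g a b c)
    simpa using this
  linarith [bi u v w z, bi v w z u, bi w z u v, bi z u v w, sw u v w z, riem_skew g u v w z,
    sw v w u z, riem_skew g v w u z, sw w u v z, riem_skew g w u v z, sw v w z u,
    sw w z v u, riem_skew g w z v u, sw z v w u, riem_skew g z v w u, sw w z u v,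
    riem_skew g w z u v, sw z u w v, riem_skew g z u w v, sw u w z v, riem_skew g u w z v,
    sw z u v w, riem_skew g z u v w, sw v z u w, riem_skew g v z u w, sw u v z w, sw w u z v,
    riem_skew g w u z v, riem_skew g v w z u]

/-- The endomorphism `w ↦ R(w, u)v` of the tangent space at `x`. -/
noncomputable def riemEnd (x : M) (u v : TangentSpace 𝓘(ℝ, E) x) :
    TangentSpace 𝓘(ℝ, E) x →ₗ[ℝ] TangentSpace 𝓘(ℝ, E) x :=
  (curvature_tensorial_fst g (Y := FiberBundle.extend E u) (smooth_extend v)).toLinearMap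

theorem riemEnd_apply (u v w : TangentSpace 𝓘(ℝ, E) x) : riemEnd g x u v w = riem g x w u v :=
  rfl

theorem ricci_eq_trace (u v : TangentSpace 𝓘(ℝ, E) x) :
    ricci g x u v = LinearMap.trace ℝ _ (riemEnd g x u v) := by
  rw [LinearMap.trace_eq_matrix_trace ℝ (finBasis ℝ (TangentSpace 𝓘(ℝ, E) x)), Matrix.trace]
  refine Finset.sum_congr rfl fun i _ ↦ ?_
  rw [Matrix.diag_apply, LinearMap.toMatrix_apply]
  rfl

theorem trace_eq_of_adjoint {B C : TangentSpace 𝓘(ℝ, E) x →ₗ[ℝ] TangentSpace 𝓘(ℝ, E) x}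
    (h : ∀ u v, g.inner x (B u) v = g.inner x u (C v)) :
    LinearMap.trace ℝ _ B = LinearMap.trace ℝ _ C := by
  have h1 : Dual.transpose (R := ℝ) B =
      ((metricForm g x).toDual (metricForm_nondegenerate g x)).conj C := by
    ext a u
    obtain ⟨v, rfl⟩ := ((metricForm g x).toDual (metricForm_nondegenerate g x)).surjective a
    rw [LinearEquiv.conj_apply_apply, LinearEquiv.symm_apply_apply]
    simp only [Dual.transpose_apply, LinearMap.comp_apply, LinearMap.BilinForm.toDual_def]
    rw [show metricForm g x v (B u) = g.inner x (B u) v from g.symm x v (B u), h, g.symm]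
    rfl
  rw [← LinearMap.trace_transpose' (R := ℝ) B, h1, LinearMap.trace_conj']

theorem trace_eq_zero_of_skew {B : TangentSpace 𝓘(ℝ, E) x →ₗ[ℝ] TangentSpace 𝓘(ℝ, E) x}
    (h : ∀ u v, g.inner x (B u) v = -g.inner x u (B v)) : LinearMap.trace ℝ _ B = 0 := by
  have := trace_eq_of_adjoint g (B := B) (C := -B) (fun u v ↦ by simp [h u v])
  rw [map_neg] at this
  linarith

theorem ricci_symm (u v : TangentSpace 𝓘(ℝ, E) x) : ricci g x u v = ricci g x v u := by
  rw [ricci_eq_trace, ricci_eq_trace]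
  refine trace_eq_of_adjoint g fun w z ↦ ?_
  rw [riemEnd_apply, riemEnd_apply, riem_pair_symm, riem_swap, g.symm x w]
  rw [riem_skew g z v u w]
  simp

theorem ricci_add_right (u v v' : TangentSpace 𝓘(ℝ, E) x) :
    ricci g x u (v + v') = ricci g x u v + ricci g x u v' := by
  simp only [ricci_eq_trace, ← map_add]
  congr 1
  ext w
  exact (curvature_tensorial_trd g (smooth_extend w) (smooth_extend u)).toLinearMap.map_add v v'

theorem ricci_smul_right (c : ℝ) (u v : TangentSpace 𝓘(ℝ, E) x) :
    ricci g x u (c • v) = c * ricci g x u v := by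
  rw [ricci_eq_trace, ricci_eq_trace, ← smul_eq_mul, ← map_smul]
  congr 1
  ext w
  exact (curvature_tensorial_trd g (smooth_extend w) (smooth_extend u)).toLinearMap.map_smul c v

end Curvature

/-! ### The rank of a two-form with a vanishing exterior power -/

section Exterior

variable {V ι : Type*} [AddCommGroup V] [Module ℝ V] [Fintype ι] (b : Basis ι ℝ V)

/-- The element `(1 / 2) ∑ B(bᵢ, bⱼ) bⁱ ∧ bʲ` of `Λ V*` given by a bilinear form `B`. -/
noncomputable def twoForm (B : V →ₗ[ℝ] V →ₗ[ℝ] ℝ) : ExteriorAlgebra ℝ (Dual ℝ V) :=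
  (1 / 2 : ℝ) • ∑ i, ∑ j, B (b i) (b j) •
    (ExteriorAlgebra.ι ℝ (b.coord i) * ExteriorAlgebra.ι ℝ (b.coord j))

theorem ι_mul_swap (a c : Dual ℝ V) : ExteriorAlgebra.ι ℝ a * ExteriorAlgebra.ι ℝ c =
    -(ExteriorAlgebra.ι ℝ c * ExteriorAlgebra.ι ℝ a) :=
  eq_neg_of_add_eq_zero_left (ExteriorAlgebra.ι_add_mul_swap a c)

theorem commute_ι_mul_ι (a c d : Dual ℝ V) :
    Commute (ExteriorAlgebra.ι ℝ d) (ExteriorAlgebra.ι ℝ a * ExteriorAlgebra.ι ℝ c) := by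
  rw [commute_iff_eq, ← mul_assoc, ι_mul_swap d a, neg_mul, mul_assoc, ι_mul_swap d c, mul_neg,
    neg_neg, mul_assoc]

theorem commute_ι_twoForm (B : V →ₗ[ℝ] V →ₗ[ℝ] ℝ) (d : Dual ℝ V) :
    Commute (ExteriorAlgebra.ι ℝ d) (twoForm b B) :=
  (Commute.sum_right _ _ _ fun _ _ ↦ Commute.sum_right _ _ _ fun _ _ ↦
    (commute_ι_mul_ι _ _ d).smul_right _).smul_right _

theorem commute_twoForm_twoForm (B C : V →ₗ[ℝ] V →ₗ[ℝ] ℝ) :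
    Commute (twoForm b B) (twoForm b C) :=
  (Commute.sum_left _ _ _ fun _ _ ↦ Commute.sum_left _ _ _ fun _ _ ↦
    (((commute_ι_twoForm b C _).mul_left (commute_ι_twoForm b C _)).smul_left _)).smul_left _

theorem sum_apply_smul_ι (a : Dual ℝ V) :
    ∑ i, a (b i) • ExteriorAlgebra.ι ℝ (b.coord i) = ExteriorAlgebra.ι ℝ a := by
  rw [← b.sum_dual_apply_smul_coord a, map_sum]
  simp

theorem twoForm_sub_wedge (B : V →ₗ[ℝ] V →ₗ[ℝ] ℝ) (a c : Dual ℝ V) :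
    twoForm b (B - (a.smulRight c - c.smulRight a)) =
      twoForm b B - ExteriorAlgebra.ι ℝ a * ExteriorAlgebra.ι ℝ c := by
  have h : ∀ a c : Dual ℝ V, ∑ i, ∑ j, (a (b i) * c (b j)) •
      (ExteriorAlgebra.ι ℝ (b.coord i) * ExteriorAlgebra.ι ℝ (b.coord j)) =
      ExteriorAlgebra.ι ℝ a * ExteriorAlgebra.ι ℝ c := by
    intro a c
    rw [← sum_apply_smul_ι b a, ← sum_apply_smul_ι b c, Finset.sum_mul_sum]
    simp only [smul_mul_smul_comm]
  simp only [twoForm, LinearMap.sub_apply, LinearMap.smulRight_apply, LinearMap.smul_apply,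
    smul_eq_mul, sub_smul, Finset.sum_sub_distrib, h]
  rw [ι_mul_swap c a]
  module

/-- The interior product with `v`. -/
noncomputable abbrev interior (v : V) :
    ExteriorAlgebra ℝ (Dual ℝ V) →ₗ[ℝ] ExteriorAlgebra ℝ (Dual ℝ V) :=
  CliffordAlgebra.contractLeft (Dual.eval ℝ V v)

theorem interior_ι_mul (v : V) (a : Dual ℝ V) (y : ExteriorAlgebra ℝ (Dual ℝ V)) :
    interior v (ExteriorAlgebra.ι ℝ a * y) = a v • y - ExteriorAlgebra.ι ℝ a * interior v y :=
  CliffordAlgebra.contractLeft_ι_mul _ _ _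

theorem interior_twoForm_mul {B : V →ₗ[ℝ] V →ₗ[ℝ] ℝ} (hB : ∀ u v, B u v = -B v u) (v : V)
    (y : ExteriorAlgebra ℝ (Dual ℝ V)) :
    interior v (twoForm b B * y) = ExteriorAlgebra.ι ℝ (B v) * y + twoForm b B * interior v y := by
  have h : ∑ i, ∑ j, (B (b i) (b j) * b.coord i v) • ExteriorAlgebra.ι ℝ (b.coord j) =
      ExteriorAlgebra.ι ℝ (B v) := by
    rw [Finset.sum_comm, ← sum_apply_smul_ι b (B v)]
    refine Finset.sum_congr rfl fun j _ ↦ ?_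
    rw [← Finset.sum_smul]
    congr 1
    have h := congrArg (fun t ↦ B t (b j)) (b.sum_repr v)
    simp only [map_sum, map_smul, LinearMap.sum_apply, LinearMap.smul_apply, smul_eq_mul] at h
    rw [← h]
    exact Finset.sum_congr rfl fun i _ ↦ mul_comm _ _
  have h' : ∑ i, ∑ j, (B (b i) (b j) * b.coord j v) • ExteriorAlgebra.ι ℝ (b.coord i) =
      -ExteriorAlgebra.ι ℝ (B v) := by
    rw [Finset.sum_comm, ← h, ← Finset.sum_neg_distrib]
    refine Finset.sum_congr rfl fun j _ ↦ ?_
    rw [← Finset.sum_neg_distrib]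
    refine Finset.sum_congr rfl fun i _ ↦ ?_
    rw [hB, neg_mul, neg_smul]
  have h2 : ∀ i j, interior v (ExteriorAlgebra.ι ℝ (b.coord i) * ExteriorAlgebra.ι ℝ (b.coord j) * y)
      = b.coord i v • ExteriorAlgebra.ι ℝ (b.coord j) * y
        - b.coord j v • ExteriorAlgebra.ι ℝ (b.coord i) * y
        + ExteriorAlgebra.ι ℝ (b.coord i) * ExteriorAlgebra.ι ℝ (b.coord j) * interior v y := by
    intro i j
    rw [mul_assoc, interior_ι_mul, interior_ι_mul, mul_sub, mul_smul_comm]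
    simp only [smul_mul_assoc, mul_assoc]
    abel
  have h3 : interior v (twoForm b B * y) = (1 / 2 : ℝ) •
      ((∑ i, ∑ j, (B (b i) (b j) * b.coord i v) • ExteriorAlgebra.ι ℝ (b.coord j)) * y
      - (∑ i, ∑ j, (B (b i) (b j) * b.coord j v) • ExteriorAlgebra.ι ℝ (b.coord i)) * y)
      + twoForm b B * interior v y := by
    simp only [twoForm, smul_mul_assoc, Finset.sum_mul, map_smul, map_sum, h2, smul_add, smul_sub,
      Finset.sum_add_distrib, Finset.sum_sub_distrib, mul_smul]
  rw [h3, h, h', neg_mul]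
  module

theorem interior_twoForm_pow {B : V →ₗ[ℝ] V →ₗ[ℝ] ℝ} (hB : ∀ u v, B u v = -B v u) (v : V) (k : ℕ) :
    interior v (twoForm b B ^ (k + 1)) =
      ((k : ℝ) + 1) • (ExteriorAlgebra.ι ℝ (B v) * twoForm b B ^ k) := by
  induction k with
  | zero =>
    have := interior_twoForm_mul b hB v 1
    simpa [CliffordAlgebra.contractLeft_one] using this
  | succ k ih =>
    rw [pow_succ', interior_twoForm_mul b hB, ih, mul_smul_comm, ← mul_assoc,
      ← (commute_ι_twoForm b B (B v)).eq, mul_assoc, ← pow_succ']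
    push_cast
    module

theorem wedge_volume_swap (B C : V →ₗ[ℝ] V →ₗ[ℝ] ℝ) (a c : Dual ℝ V) (p q : ℕ) :
    ExteriorAlgebra.ι ℝ a * twoForm b B ^ p * ExteriorAlgebra.ι ℝ c * twoForm b C ^ q =
      -(ExteriorAlgebra.ι ℝ c * twoForm b C ^ q * ExteriorAlgebra.ι ℝ a * twoForm b B ^ p) := by
  have h1 := ((commute_ι_twoForm b B c).pow_right p).eq
  have h2 := ((commute_ι_twoForm b C a).pow_right q).eq
  have h3 := ((commute_twoForm_twoForm b B C).pow_pow p q).eq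
  rw [mul_assoc (ExteriorAlgebra.ι ℝ a), ← h1, ← mul_assoc, ι_mul_swap a c, mul_assoc, h3, neg_mul,
    mul_assoc (ExteriorAlgebra.ι ℝ c) _ (ExteriorAlgebra.ι ℝ a), ← h2]
  simp only [mul_assoc]

theorem sub_pow_succ_of_sq_zero {A : Type*} [Ring A] {s t : A} (h : Commute s t) (ht : t * t = 0)
    (n : ℕ) : (s - t) ^ (n + 1) = s ^ (n + 1) - (n + 1 : ℕ) • (t * s ^ n) := by
  induction n with
  | zero => simp
  | succ n ih =>
    rw [pow_succ', ih, sub_mul, mul_sub, mul_sub, mul_smul_comm, mul_smul_comm, ← mul_assoc t t, ht,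
      zero_mul, smul_zero, sub_zero, ← mul_assoc s t, h.eq, mul_assoc t s, ← pow_succ', ← pow_succ',
      succ_nsmul _ (n + 1)]
    abel

/-- An alternating form whose `(k + 1)`-st exterior power vanishes has rank at most `2k`. Splitting
off a hyperbolic plane lowers `k` by one and the rank by at most two. -/
theorem finrank_range_le_of_twoForm_pow_eq_zero [FiniteDimensional ℝ V] (k : ℕ)
    (B : V →ₗ[ℝ] V →ₗ[ℝ] ℝ) (hB : ∀ u v, B u v = -B v u) (h : twoForm b B ^ (k + 1) = 0) :
    finrank ℝ (LinearMap.range B) ≤ 2 * k := by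
  induction k generalizing B with
  | zero =>
    have hB0 : B = 0 := by
      refine LinearMap.ext fun v ↦ ?_
      have h1 := interior_twoForm_pow b hB v 0
      rw [h] at h1
      simpa using h1.symm
    simp [hB0]
  | succ k ih =>
    by_cases hB0 : B = 0
    · rw [hB0, LinearMap.range_zero, finrank_bot]
      exact Nat.zero_le _
    obtain ⟨u, w, huw⟩ : ∃ u w, B u w = 1 := by
      by_contra! hne
      refine hB0 ?_
      refine LinearMap.ext fun u ↦ LinearMap.ext fun w ↦ ?_
      by_contra h0
      refine hne ((B u w)⁻¹ • u) w ?_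
      rw [map_smul, LinearMap.smul_apply, smul_eq_mul]
      exact inv_mul_cancel₀ h0
    set Θ := twoForm b B with hΘ
    set τ := ExteriorAlgebra.ι ℝ (B u) * ExteriorAlgebra.ι ℝ (B w) with hτ
    have hττ : τ * τ = 0 := by
      rw [hτ, ← mul_assoc, mul_assoc _ _ (ExteriorAlgebra.ι ℝ (B u)), ι_mul_swap (B w)]
      simp [← mul_assoc]
    have hcomm : Commute Θ τ :=
      ((commute_ι_twoForm b B (B u)).mul_left (commute_ι_twoForm b B (B w))).symm
    have h1 : ((k : ℝ) + 1 + 1) • (Θ ^ (k + 1) - ((k : ℝ) + 1) • (τ * Θ ^ k)) = 0 := by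
      have h2 := congrArg (interior w) (interior_twoForm_pow b hB u (k + 1))
      rw [h, map_zero, map_zero, map_smul, interior_ι_mul, interior_twoForm_pow b hB, huw, one_smul,
        mul_smul_comm, ← mul_assoc] at h2
      push_cast at h2
      exact h2.symm
    have h3 := (smul_eq_zero.1 h1).resolve_left (by positivity)
    have h4 : twoForm b (B - ((B u).smulRight (B w) - (B w).smulRight (B u))) ^ (k + 1) = 0 := by
      rw [twoForm_sub_wedge, sub_pow_succ_of_sq_zero hcomm hττ, ← h3, ← Nat.cast_smul_eq_nsmul ℝ]
      push_cast
      rfl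
    set B' := B - ((B u).smulRight (B w) - (B w).smulRight (B u)) with hB'
    have h5 := ih B' (fun y z ↦ by simp [hB', hB y z]; ring) h4
    have h6 : LinearMap.range B ≤ LinearMap.range B' ⊔ Submodule.span ℝ {B u, B w} := by
      rintro _ ⟨v, rfl⟩
      have : B v = B' v + (B u v • B w - B w v • B u) := by simp [hB']
      rw [this]
      refine Submodule.add_mem_sup ⟨v, rfl⟩ (Submodule.sub_mem _ ?_ ?_) <;>
      exact Submodule.smul_mem _ _ (Submodule.subset_span (by simp))
    have h7 : finrank ℝ (Submodule.span ℝ {B u, B w}) ≤ 2 := by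
      classical
      have := finrank_span_finset_le_card (R := ℝ) ({B u, B w} : Finset (Dual ℝ V))
      simp only [Finset.coe_insert, Finset.coe_singleton] at this
      exact this.trans Finset.card_le_two
    calc finrank ℝ (LinearMap.range B)
        ≤ finrank ℝ ↥(LinearMap.range B' ⊔ Submodule.span ℝ {B u, B w}) :=
          Submodule.finrank_mono h6
      _ ≤ finrank ℝ (LinearMap.range B') + finrank ℝ (Submodule.span ℝ {B u, B w}) :=
          Submodule.finrank_add_le_finrank_add_finrank _ _
      _ ≤ 2 * (k + 1) := by omega

end Exterior

/-! ### The pointwise algebra of a metric contact pair -/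

section Pointwise

variable {E : Type*} [NormedAddCommGroup E] [NormedSpace ℝ E] [FiniteDimensional ℝ E]
  {M : Type*} [TopologicalSpace M] [ChartedSpace E M] [IsManifold 𝓘(ℝ, E) ∞ M]

theorem OneForm.d_swap (α : OneForm E M) {x : M} (u v : TangentSpace 𝓘(ℝ, E) x) :
    α.d x u v = -α.d x v u :=
  α.dAux_swap _ _ _

/-- A bilinear form on a tangent space, without its topology. -/
noncomputable def bilin {x : M} (B : TangentSpace 𝓘(ℝ, E) x →L[ℝ] TangentSpace 𝓘(ℝ, E) x →L[ℝ] ℝ) :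
    TangentSpace 𝓘(ℝ, E) x →ₗ[ℝ] TangentSpace 𝓘(ℝ, E) x →ₗ[ℝ] ℝ :=
  ContinuousLinearMap.coeLM ℝ ∘ₗ B.toLinearMap

theorem extTwo_eq_twoForm {x : M}
    (B : TangentSpace 𝓘(ℝ, E) x →L[ℝ] TangentSpace 𝓘(ℝ, E) x →L[ℝ] ℝ) :
    extTwo B = twoForm (finBasis ℝ (TangentSpace 𝓘(ℝ, E) x)) (bilin B) :=
  rfl

namespace AlmostContactPair

variable {p q : ℕ} (S : AlmostContactPair E M p q) {g : Metric E M}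

/-- The same structure with the roles of `α₁` and `α₂` exchanged. -/
noncomputable def swap : AlmostContactPair E M q p where
  α₁ := S.α₂
  α₂ := S.α₁
  Z₁ := S.Z₂
  Z₂ := S.Z₁
  φ := S.φ
  contact :=
    { p_pos := S.contact.q_pos
      q_pos := S.contact.p_pos
      dim := by rw [S.contact.dim]; ring
      volume := fun x h ↦ S.contact.volume x
        ((wedge_volume_swap (finBasis ℝ (TangentSpace 𝓘(ℝ, E) x)) (bilin (S.α₁.d x))
          (bilin (S.α₂.d x)) _ _ p q).trans (neg_eq_zero.2 h))
      pow₁ := S.contact.pow₂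
      pow₂ := S.contact.pow₁ }
  reeb :=
    { smooth₁ := S.reeb.smooth₂
      smooth₂ := S.reeb.smooth₁
      apply₁₁ := S.reeb.apply₂₂
      apply₂₂ := S.reeb.apply₁₁
      apply₁₂ := S.reeb.apply₂₁
      apply₂₁ := S.reeb.apply₁₂
      contract₁₁ := S.reeb.contract₂₂
      contract₂₁ := S.reeb.contract₁₂
      contract₁₂ := S.reeb.contract₂₁
      contract₂₂ := S.reeb.contract₁₁ }
  φ_sq x v := by rw [S.φ_sq]; abel
  φ_Z₁ := S.φ_Z₂
  φ_Z₂ := S.φ_Z₁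

variable {S}

theorem IsNormalMetricContactPair.swap (hS : S.IsNormalMetricContactPair g) :
    S.swap.IsNormalMetricContactPair g where
  decomposable x v := (hS.decomposable x v).symm
  associated :=
    { apply_φ := fun x u v ↦ (hS.associated.apply_φ x u v).trans (add_comm _ _)
      apply_Z₁ := hS.associated.apply_Z₂
      apply_Z₂ := hS.associated.apply_Z₁ }
  normal := by
    have hJ : S.swap.J = S.T := by
      funext x
      simp only [J, T, AlmostContactPair.swap]
      abel
    have hT : S.swap.T = S.J := by
      funext x
      simp only [J, T, AlmostContactPair.swap]
      abel
    exact ⟨hJ ▸ hS.normal.2, hT ▸ hS.normal.1⟩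

section

variable (hA : S.IsAssociated g) {x : M}
include hA

theorem α₁_φ (v : TangentSpace 𝓘(ℝ, E) x) : S.α₁ x (S.φ.toFun x v) = 0 := by
  rw [← hA.apply_Z₁, g.symm, hA.apply_φ, S.reeb.contract₁₁, S.reeb.contract₂₁]
  simp

theorem α₂_φ (v : TangentSpace 𝓘(ℝ, E) x) : S.α₂ x (S.φ.toFun x v) = 0 := by
  rw [← hA.apply_Z₂, g.symm, hA.apply_φ, S.reeb.contract₁₂, S.reeb.contract₂₂]
  simp

theorem inner_φ (u v : TangentSpace 𝓘(ℝ, E) x) :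
    g.inner x (S.φ.toFun x u) v = -g.inner x u (S.φ.toFun x v) := by
  rw [g.symm, hA.apply_φ, hA.apply_φ, OneForm.d_swap, OneForm.d_swap S.α₂]
  ring

/-- A vector in the kernel of `dα₁ + dα₂` is a combination of the Reeb vectors. -/
theorem eq_of_d_eq_zero {u : TangentSpace 𝓘(ℝ, E) x}
    (h : ∀ v, S.α₁.d x u v + S.α₂.d x u v = 0) :
    u = S.α₁ x u • S.Z₁ x + S.α₂ x u • S.Z₂ x := by
  have h1 : S.φ.toFun x u = 0 := by
    refine inner_ext g fun w ↦ ?_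
    rw [inner_φ hA, hA.apply_φ, h]
    simp
  have h2 := S.φ_sq x u
  rw [h1, map_zero] at h2
  rw [← sub_eq_zero, ← neg_eq_zero, h2]
  abel

end

variable (S) in
/-- The tangent space `ker α₁ ∩ ker dα₁` of the first characteristic foliation. -/
noncomputable def foliation₁ (x : M) : Submodule ℝ (TangentSpace 𝓘(ℝ, E) x) :=
  LinearMap.ker (S.α₁ x).toLinearMap ⊓ LinearMap.ker (bilin (S.α₁.d x))

theorem mem_foliation₁ {x : M} {v : TangentSpace 𝓘(ℝ, E) x} :
    v ∈ S.foliation₁ x ↔ S.α₁ x v = 0 ∧ S.α₁.d x v = 0 := by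
  simp only [foliation₁, bilin, Submodule.mem_inf, LinearMap.mem_ker, LinearMap.comp_apply]
  exact and_congr Iff.rfl (ContinuousLinearMap.coe_inj (f := S.α₁.d x v) (g := 0))

variable (S) in
theorem le_finrank_foliation₁ (x : M) : 2 * q + 1 ≤ finrank ℝ (S.foliation₁ x) := by
  have h1 : finrank ℝ (LinearMap.range (bilin (S.α₁.d x))) ≤ 2 * p :=
    finrank_range_le_of_twoForm_pow_eq_zero (finBasis ℝ (TangentSpace 𝓘(ℝ, E) x)) p _
      (fun u v ↦ S.α₁.d_swap u v) (by rw [← extTwo_eq_twoForm]; exact S.contact.pow₁ x)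
  have h2 := LinearMap.finrank_range_add_finrank_ker (bilin (S.α₁.d x))
  have h3 := LinearMap.finrank_range_add_finrank_ker (S.α₁ x).toLinearMap
  have h4 : finrank ℝ (LinearMap.range (S.α₁ x).toLinearMap) ≤ 1 := by
    simpa using (LinearMap.range (S.α₁ x).toLinearMap).finrank_le
  have h5 := Submodule.finrank_sup_add_finrank_inf_eq (LinearMap.ker (S.α₁ x).toLinearMap)
    (LinearMap.ker (bilin (S.α₁.d x)))
  have h6 := (LinearMap.ker (S.α₁ x).toLinearMap ⊔ LinearMap.ker (bilin (S.α₁.d x))).finrank_le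
  have h7 : finrank ℝ (TangentSpace 𝓘(ℝ, E) x) = 2 * p + 2 * q + 2 := S.contact.dim
  unfold foliation₁
  omega

theorem disjoint_foliations (hA : S.IsAssociated g) (x : M) :
    Disjoint (S.foliation₁ x) (S.swap.foliation₁ x) := by
  rw [Submodule.disjoint_def]
  intro v h1 h2
  rw [mem_foliation₁] at h1 h2
  have h2' : S.α₂ x v = 0 ∧ S.α₂.d x v = 0 := h2
  have := eq_of_d_eq_zero hA (u := v) (fun w ↦ by rw [h1.2, h2'.2]; simp)
  rw [this, h1.1, h2'.1]
  simp

theorem isCompl_foliations (hA : S.IsAssociated g) (x : M) :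
    IsCompl (S.foliation₁ x) (S.swap.foliation₁ x) ∧
      finrank ℝ (S.swap.foliation₁ x) = 2 * p + 1 := by
  have h1 := S.le_finrank_foliation₁ x
  have h2 := S.swap.le_finrank_foliation₁ x
  have h3 := Submodule.finrank_sup_add_finrank_inf_eq (S.foliation₁ x) (S.swap.foliation₁ x)
  rw [(disjoint_foliations hA x).eq_bot, finrank_bot] at h3
  have h4 := (S.foliation₁ x ⊔ S.swap.foliation₁ x).finrank_le
  have h7 : finrank ℝ (TangentSpace 𝓘(ℝ, E) x) = 2 * p + 2 * q + 2 := S.contact.dim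
  refine ⟨⟨disjoint_foliations hA x, ?_⟩, by omega⟩
  rw [codisjoint_iff]
  exact Submodule.eq_top_of_finrank_eq (by omega)

section

variable (hS : S.IsNormalMetricContactPair g) {x : M}
  {A : TangentSpace 𝓘(ℝ, E) x →L[ℝ] TangentSpace 𝓘(ℝ, E) x}
  (h : ∀ u w, g.inner x (A u) w = S.α₁.d x u w)
include hS

theorem φ_mem_foliation₁ {v : TangentSpace 𝓘(ℝ, E) x} (hv : v ∈ S.foliation₁ x) :
    S.φ.toFun x v ∈ S.foliation₁ x := by
  rw [mem_foliation₁] at hv ⊢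
  exact (hS.decomposable x v).1 hv

/-- Induction over the splitting of the tangent space by the two characteristic foliations. -/
theorem foliation_induction {Q : TangentSpace 𝓘(ℝ, E) x → Prop}
    (h1 : ∀ v ∈ S.foliation₁ x, Q v) (h2 : ∀ v ∈ S.swap.foliation₁ x, Q v)
    (hadd : ∀ v w, Q v → Q w → Q (v + w)) (v : TangentSpace 𝓘(ℝ, E) x) : Q v := by
  have hv : v ∈ S.foliation₁ x ⊔ S.swap.foliation₁ x := by
    rw [(isCompl_foliations hS.associated x).1.sup_eq_top]; trivial
  obtain ⟨a, ha, b, hb, rfl⟩ := Submodule.mem_sup.1 hv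
  exact hadd _ _ (h1 a ha) (h2 b hb)

include h

omit hS in
theorem apply_of_mem_foliation₁ {v : TangentSpace 𝓘(ℝ, E) x} (hv : v ∈ S.foliation₁ x) :
    A v = 0 :=
  inner_ext g fun w ↦ by rw [h, (mem_foliation₁.1 hv).2]; simp

theorem apply_of_mem_foliation₂ {v : TangentSpace 𝓘(ℝ, E) x} (hv : v ∈ S.swap.foliation₁ x) :
    A v = -S.φ.toFun x v := by
  have hv' : S.α₂.d x v = 0 := (mem_foliation₁.1 hv).2
  refine inner_ext g fun w ↦ ?_
  rw [h, map_neg, neg_apply, inner_φ hS.associated, hS.associated.apply_φ, hv']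
  simp

theorem apply_φ_comm (v : TangentSpace 𝓘(ℝ, E) x) :
    A (S.φ.toFun x v) = S.φ.toFun x (A v) := by
  refine foliation_induction hS (Q := fun v ↦ A (S.φ.toFun x v) = S.φ.toFun x (A v))
      (fun v hv ↦ ?_) (fun v hv ↦ ?_) (fun v w h1 h2 ↦ ?_) v
  · rw [apply_of_mem_foliation₁ h hv, apply_of_mem_foliation₁ h (φ_mem_foliation₁ hS hv), map_zero]
  · have hφ : S.φ.toFun x v ∈ S.swap.foliation₁ x := φ_mem_foliation₁ hS.swap hv
    rw [apply_of_mem_foliation₂ hS h hv, apply_of_mem_foliation₂ hS h hφ, map_neg]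
  · simp [h1, h2]

theorem apply_apply (v : TangentSpace 𝓘(ℝ, E) x) : A (A v) = -S.φ.toFun x (A v) := by
  refine foliation_induction hS (Q := fun v ↦ A (A v) = -S.φ.toFun x (A v))
      (fun v hv ↦ ?_) (fun v hv ↦ ?_) (fun v w h1 h2 ↦ ?_) v
  · rw [apply_of_mem_foliation₁ h hv]; simp
  · rw [apply_of_mem_foliation₂ hS h hv, map_neg, apply_φ_comm hS h,
      apply_of_mem_foliation₂ hS h hv]
  · rw [map_add, map_add, h1, h2]; simp [add_comm]

omit hS in
theorem apply_Z₁ : A (S.Z₁ x) = 0 :=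
  inner_ext g fun w ↦ by rw [h, S.reeb.contract₁₁]; simp

omit hS in
theorem apply_Z₂ : A (S.Z₂ x) = 0 :=
  inner_ext g fun w ↦ by rw [h, S.reeb.contract₁₂]; simp

omit hS in
theorem inner_apply (u v : TangentSpace 𝓘(ℝ, E) x) :
    g.inner x (A u) v = -g.inner x u (A v) := by
  rw [h, g.symm, h, S.α₁.d_swap]

theorem α₁_apply (v : TangentSpace 𝓘(ℝ, E) x) : S.α₁ x (A v) = 0 := by
  rw [← hS.associated.apply_Z₁, inner_apply h, apply_Z₁ h]; simp

theorem α₂_apply (v : TangentSpace 𝓘(ℝ, E) x) : S.α₂ x (A v) = 0 := by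
  rw [← hS.associated.apply_Z₂, inner_apply h, apply_Z₂ h]; simp

theorem φ_apply_of_mem_foliation₂ {v : TangentSpace 𝓘(ℝ, E) x} (hv : v ∈ S.swap.foliation₁ x) :
    S.φ.toFun x (A v) = v - S.α₁ x v • S.Z₁ x := by
  have hv' : S.α₂ x v = 0 := (mem_foliation₁.1 hv).1
  rw [apply_of_mem_foliation₂ hS h hv, map_neg, S.φ_sq, hv']
  module

/-- `φ A = -A²` is idempotent: it is the projection onto the horizontal part of the tangent space of
the second characteristic foliation. -/
theorem φ_apply_idem (v : TangentSpace 𝓘(ℝ, E) x) :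
    S.φ.toFun x (A (S.φ.toFun x (A v))) = S.φ.toFun x (A v) := by
  refine foliation_induction hS
      (Q := fun v ↦ S.φ.toFun x (A (S.φ.toFun x (A v))) = S.φ.toFun x (A v))
      (fun v hv ↦ ?_) (fun v hv ↦ ?_) (fun v w h1 h2 ↦ ?_) v
  · rw [apply_of_mem_foliation₁ h hv]; simp
  · conv_lhs => rw [φ_apply_of_mem_foliation₂ hS h hv]
    rw [map_sub, map_smul, apply_Z₁ h]; simp
  · simp only [map_add, h1, h2]

theorem trace_φ_apply :
    LinearMap.trace ℝ _ ((S.φ.toFun x).toLinearMap ∘ₗ A.toLinearMap) = 2 * p := by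
  have h1 : LinearMap.IsProj (S.swap.foliation₁ x)
      ((S.φ.toFun x).toLinearMap ∘ₗ A.toLinearMap
        + (S.α₁ x).toLinearMap.smulRight (S.Z₁ x)) := by
    have key : ∀ v ∈ S.swap.foliation₁ x, ((S.φ.toFun x).toLinearMap ∘ₗ A.toLinearMap
        + (S.α₁ x).toLinearMap.smulRight (S.Z₁ x)) v = v := by
      intro v hv
      have := φ_apply_of_mem_foliation₂ hS h hv
      simp [this]
    refine ⟨fun v ↦ ?_, key⟩
    refine foliation_induction hS (Q := fun v ↦ ((S.φ.toFun x).toLinearMap ∘ₗ A.toLinearMap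
        + (S.α₁ x).toLinearMap.smulRight (S.Z₁ x)) v ∈ S.swap.foliation₁ x)
      (fun v hv ↦ ?_) (fun v hv ↦ ?_) (fun v w h1 h2 ↦ ?_) v
    · have h2 := apply_of_mem_foliation₁ h hv
      have h3 := (mem_foliation₁.1 hv).1
      simp [h2, h3]
    · rw [key v hv]; exact hv
    · rw [map_add]; exact add_mem h1 h2
  have h2 := h1.trace
  rw [(isCompl_foliations hS.associated x).2, map_add] at h2
  have h3 : LinearMap.trace ℝ _ ((S.α₁ x).toLinearMap.smulRight (S.Z₁ x)) = 1 := by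
    rw [LinearMap.trace_smulRight]
    exact S.reeb.apply₁₁ x
  rw [h3] at h2
  push_cast at h2
  linarith

end

end AlmostContactPair

end Pointwise

/-! ### The exterior derivative of a one-form is closed -/

section Closed

variable {E : Type*} [NormedAddCommGroup E] [NormedSpace ℝ E] [FiniteDimensional ℝ E]
  {M : Type*} [TopologicalSpace M] [ChartedSpace E M] [IsManifold 𝓘(ℝ, E) ∞ M]
  {x : M} {X Y W : Π x : M, TangentSpace 𝓘(ℝ, E) x}

theorem OneForm.eventually_d (α : OneForm E M) (hX : CMDiffAt ∞ (T% X) x)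
    (hY : CMDiffAt ∞ (T% Y) x) : (fun y ↦ α.d y (X y) (Y y)) =ᶠ[nhds x]
      fun y ↦ (1 / 2 : ℝ) * (mvfderiv 𝓘(ℝ, E) (fun y ↦ α y (Y y)) y (X y)
        - mvfderiv 𝓘(ℝ, E) (fun y ↦ α y (X y)) y (Y y) - α y (mlieBracket 𝓘(ℝ, E) X Y y)) := by
  filter_upwards [eventually_mdiffAt_of_smooth hX, eventually_mdiffAt_of_smooth hY] with y h1 h2
  exact α.d_apply h1 h2

theorem OneForm.smooth_d (α : OneForm E M) (hX : CMDiffAt ∞ (T% X) x)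
    (hY : CMDiffAt ∞ (T% Y) x) : CMDiffAt ∞ (fun y ↦ α.d y (X y) (Y y)) x := by
  refine ContMDiffAt.congr_of_eventuallyEq ?_ (α.eventually_d hX hY)
  exact contMDiffAt_const.mul (((smooth_mvfderiv (α.smooth_apply hY) hX).sub
    (smooth_mvfderiv (α.smooth_apply hX) hY)).sub (α.smooth_apply (smooth_mlieBracket hX hY)))

theorem OneForm.mvfderiv_d (α : OneForm E M) (hX : CMDiffAt ∞ (T% X) x)
    (hY : CMDiffAt ∞ (T% Y) x) (w : TangentSpace 𝓘(ℝ, E) x) :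
    mvfderiv 𝓘(ℝ, E) (fun y ↦ α.d y (X y) (Y y)) x w =
      (1 / 2 : ℝ) * (mvfderiv 𝓘(ℝ, E) (fun y ↦ mvfderiv 𝓘(ℝ, E) (fun y ↦ α y (Y y)) y (X y)) x w
        - mvfderiv 𝓘(ℝ, E) (fun y ↦ mvfderiv 𝓘(ℝ, E) (fun y ↦ α y (X y)) y (Y y)) x w
        - mvfderiv 𝓘(ℝ, E) (fun y ↦ α y (mlieBracket 𝓘(ℝ, E) X Y y)) x w) := by
  have s1 := smooth_mvfderiv (α.smooth_apply hY) hX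
  have s2 := smooth_mvfderiv (α.smooth_apply hX) hY
  have s3 := α.smooth_apply (smooth_mlieBracket hX hY)
  have d1 := mvfderiv_smooth_sub s1 s2
  have d2 := mvfderiv_smooth_sub (s1.sub s2) s3
  have d3 := mvfderiv_mul (mdifferentiableAt_const (I := 𝓘(ℝ, E)) (x := x) (c := (1 / 2 : ℝ)))
    (((s1.sub s2).sub s3).mdifferentiableAt (by simp))
  simp only [Pi.mul_def, mvfderiv_const] at d1 d2 d3
  rw [mvfderiv_congr (α.eventually_d hX hY), d3, d2, d1]
  simp

/-- `d(dα) = 0`. -/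
theorem OneForm.d_closed (α : OneForm E M) (hX : CMDiffAt ∞ (T% X) x) (hY : CMDiffAt ∞ (T% Y) x)
    (hW : CMDiffAt ∞ (T% W) x) :
    mvfderiv 𝓘(ℝ, E) (fun y ↦ α.d y (Y y) (W y)) x (X x)
      + mvfderiv 𝓘(ℝ, E) (fun y ↦ α.d y (W y) (X y)) x (Y x)
      + mvfderiv 𝓘(ℝ, E) (fun y ↦ α.d y (X y) (Y y)) x (W x) =
    α.d x (mlieBracket 𝓘(ℝ, E) X Y x) (W x) + α.d x (mlieBracket 𝓘(ℝ, E) Y W x) (X x)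
      + α.d x (mlieBracket 𝓘(ℝ, E) W X x) (Y x) := by
  rw [α.mvfderiv_d hY hW, α.mvfderiv_d hW hX, α.mvfderiv_d hX hY,
    α.d_apply (mdiffAt_of_smooth (smooth_mlieBracket hX hY)) (mdiffAt_of_smooth hW),
    α.d_apply (mdiffAt_of_smooth (smooth_mlieBracket hY hW)) (mdiffAt_of_smooth hX),
    α.d_apply (mdiffAt_of_smooth (smooth_mlieBracket hW hX)) (mdiffAt_of_smooth hY)]
  have c1 := mvfderiv_commutator (α.smooth_apply hW) hX hY
  have c2 := mvfderiv_commutator (α.smooth_apply hX) hY hW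
  have c3 := mvfderiv_commutator (α.smooth_apply hY) hW hX
  have hj : α x (mlieBracket 𝓘(ℝ, E) (mlieBracket 𝓘(ℝ, E) X Y) W x)
      + α x (mlieBracket 𝓘(ℝ, E) (mlieBracket 𝓘(ℝ, E) Y W) X x)
      + α x (mlieBracket 𝓘(ℝ, E) (mlieBracket 𝓘(ℝ, E) W X) Y x) = 0 := by
    have h := leibniz_mlieBracket_smooth hX hY hW
    have e2 : mlieBracket 𝓘(ℝ, E) Y (mlieBracket 𝓘(ℝ, E) X W) x =
        mlieBracket 𝓘(ℝ, E) (mlieBracket 𝓘(ℝ, E) W X) Y x := by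
      rw [mlieBracket_swap (V := X) (W := W), mlieBracket_swap_apply (W := Y)]
      have := mlieBracket_const_smul_right (I := 𝓘(ℝ, E)) (V := Y) (c := (-1 : ℝ))
        (mdiffAt_of_smooth (smooth_mlieBracket hW hX))
      simpa using this
    rw [mlieBracket_swap_apply, e2] at h
    have h' := congrArg (α x) h
    simp only [map_add, map_neg] at h'
    linarith
  linarith

theorem OneForm.d_closed_normal (g : Metric E M) (α : OneForm E M) (hX : CMDiffAt ∞ (T% X) x)
    (hY : CMDiffAt ∞ (T% Y) x) (hW : CMDiffAt ∞ (T% W) x) (nX : leviCivita g X x = 0)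
    (nY : leviCivita g Y x = 0) (nW : leviCivita g W x = 0) :
    mvfderiv 𝓘(ℝ, E) (fun y ↦ α.d y (Y y) (W y)) x (X x)
      + mvfderiv 𝓘(ℝ, E) (fun y ↦ α.d y (W y) (X y)) x (Y x)
      + mvfderiv 𝓘(ℝ, E) (fun y ↦ α.d y (X y) (Y y)) x (W x) = 0 := by
  rw [α.d_closed hX hY hW, mlieBracket_eq g hX hY, mlieBracket_eq g hY hW, mlieBracket_eq g hW hX]
  simp [nabla, nX, nY, nW]

variable (g : Metric E M) {B : Π x : M, TangentSpace 𝓘(ℝ, E) x →L[ℝ] TangentSpace 𝓘(ℝ, E) x}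

theorem mvfderiv_inner_end (hB : IsSmoothEnd B) (hY : CMDiffAt ∞ (T% Y) x)
    (hW : CMDiffAt ∞ (T% W) x) (nY : leviCivita g Y x = 0) (nW : leviCivita g W x = 0)
    (v : TangentSpace 𝓘(ℝ, E) x) :
    mvfderiv 𝓘(ℝ, E) (fun y ↦ g.inner y (B y (Y y)) (W y)) x v =
      g.inner x (covEnd g hB x (Y x) v) (W x) := by
  rw [mvfderiv_inner g v (hB hY) hW, covEnd_apply g hB hY, nY, nW]
  simp

theorem covEnd_skew (hB : IsSmoothEnd B)
    (h : ∀ x u v, g.inner x (B x u) v = -g.inner x u (B x v)) (u v w : TangentSpace 𝓘(ℝ, E) x) :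
    g.inner x (covEnd g hB x u w) v = -g.inner x u (covEnd g hB x v w) := by
  obtain ⟨U, hU, rfl, nU⟩ := exists_normal_extension g u
  obtain ⟨V, hV, rfl, nV⟩ := exists_normal_extension g v
  rw [← mvfderiv_inner_end g hB hU hV nU nV, g.symm x (U x), ← mvfderiv_inner_end g hB hV hU nV nU,
    ← neg_apply, ← mvfderiv_neg]
  congr 2
  funext y
  rw [h, Pi.neg_apply, g.symm y (U y)]

/-- The cyclic identity for the covariant derivative of the endomorphism that represents a closed
two-form. -/
theorem covEnd_cyclic (hB : IsSmoothEnd B) (α : OneForm E M)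
    (h : ∀ x u v, g.inner x (B x u) v = α.d x u v) (u v w : TangentSpace 𝓘(ℝ, E) x) :
    g.inner x (covEnd g hB x v u) w + g.inner x (covEnd g hB x w v) u
      + g.inner x (covEnd g hB x u w) v = 0 := by
  obtain ⟨U, hU, rfl, nU⟩ := exists_normal_extension g u
  obtain ⟨V, hV, rfl, nV⟩ := exists_normal_extension g v
  obtain ⟨W, hW, rfl, nW⟩ := exists_normal_extension g w
  rw [← mvfderiv_inner_end g hB hV hW nV nW, ← mvfderiv_inner_end g hB hW hU nW nU,
    ← mvfderiv_inner_end g hB hU hV nU nV]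
  simp only [h]
  exact α.d_closed_normal g hU hV hW nU nV nW

end Closed

/-! ### The Reeb vector fields are Killing -/

section Killing

variable {E : Type*} [NormedAddCommGroup E] [NormedSpace ℝ E] [FiniteDimensional ℝ E]
  {M : Type*} [TopologicalSpace M] [ChartedSpace E M] [IsManifold 𝓘(ℝ, E) ∞ M]
  {x : M} {X Y Z : Π x : M, TangentSpace 𝓘(ℝ, E) x}

theorem OneForm.apply_lie (α : OneForm E M) {c : ℝ} (hZ : CMDiffAt ∞ (T% Z) x)
    (hc : ∀ y, α y (Z y) = c) (h0 : α.d x (Z x) = 0) (hX : CMDiffAt ∞ (T% X) x) :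
    α x (mlieBracket 𝓘(ℝ, E) Z X x) = mvfderiv 𝓘(ℝ, E) (fun y ↦ α y (X y)) x (Z x) := by
  have h := α.d_apply (mdiffAt_of_smooth hZ) (mdiffAt_of_smooth hX)
  simp only [hc, mvfderiv_const, h0, zero_apply] at h
  linarith

/-- If `dα` vanishes on `Z` then `dα` is invariant under `Z`. -/
theorem OneForm.lie_d (α : OneForm E M) (hZ : CMDiffAt ∞ (T% Z) x) (h0 : ∀ y, α.d y (Z y) = 0)
    (hX : CMDiffAt ∞ (T% X) x) (hY : CMDiffAt ∞ (T% Y) x) :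
    mvfderiv 𝓘(ℝ, E) (fun y ↦ α.d y (X y) (Y y)) x (Z x) =
      α.d x (mlieBracket 𝓘(ℝ, E) Z X x) (Y x) + α.d x (X x) (mlieBracket 𝓘(ℝ, E) Z Y x) := by
  have h := α.d_closed hZ hX hY
  have h1 : ∀ y v, α.d y v (Z y) = 0 := fun y v ↦ by rw [α.d_swap, h0]; simp
  simp only [h1, h0, zero_apply, mvfderiv_const] at h
  rw [mlieBracket_swap_apply (V := Y) (W := Z), map_neg, neg_apply,
    α.d_swap _ (X x)] at h
  linarith

/-- The Lie derivative of the metric along `Z`, in terms of `∇Z`. -/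
theorem lie_metric (g : Metric E M) (hZ : CMDiffAt ∞ (T% Z) x) (hX : CMDiffAt ∞ (T% X) x)
    (hY : CMDiffAt ∞ (T% Y) x) :
    g.inner x (leviCivita g Z x (X x)) (Y x) + g.inner x (X x) (leviCivita g Z x (Y x)) =
      mvfderiv 𝓘(ℝ, E) (fun y ↦ g.inner y (X y) (Y y)) x (Z x)
        - g.inner x (mlieBracket 𝓘(ℝ, E) Z X x) (Y x)
        - g.inner x (X x) (mlieBracket 𝓘(ℝ, E) Z Y x) := by
  rw [mvfderiv_inner g _ hX hY, mlieBracket_eq g hZ hX, mlieBracket_eq g hZ hY]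
  simp only [nabla, map_sub, sub_apply]
  ring

namespace AlmostContactPair

variable {p q : ℕ} {S : AlmostContactPair E M p q} {g : Metric E M}

theorem smooth_Z₁ (S : AlmostContactPair E M p q) (x : M) : CMDiffAt ∞ (T% S.Z₁) x :=
  S.reeb.smooth₁ x

theorem smooth_Z₂ (S : AlmostContactPair E M p q) (x : M) : CMDiffAt ∞ (T% S.Z₂) x :=
  S.reeb.smooth₂ x

theorem lie_Z₁_Z₂ (hA : S.IsAssociated g) (x : M) : mlieBracket 𝓘(ℝ, E) S.Z₁ S.Z₂ x = 0 := by
  have a1 : S.α₁ x (mlieBracket 𝓘(ℝ, E) S.Z₁ S.Z₂ x) = 0 := by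
    rw [S.α₁.apply_lie (S.smooth_Z₁ x) S.reeb.apply₁₁ (S.reeb.contract₁₁ x) (S.smooth_Z₂ x)]
    simp [S.reeb.apply₁₂, mvfderiv_const]
  have a2 : S.α₂ x (mlieBracket 𝓘(ℝ, E) S.Z₁ S.Z₂ x) = 0 := by
    rw [S.α₂.apply_lie (S.smooth_Z₁ x) S.reeb.apply₂₁ (S.reeb.contract₂₁ x) (S.smooth_Z₂ x)]
    simp [S.reeb.apply₂₂, mvfderiv_const]
  have := eq_of_d_eq_zero hA (u := mlieBracket 𝓘(ℝ, E) S.Z₁ S.Z₂ x) fun v ↦ by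
    have h1 := S.α₁.lie_d (S.smooth_Z₁ x) S.reeb.contract₁₁ (S.smooth_Z₂ x) (smooth_extend v)
    have h2 := S.α₂.lie_d (S.smooth_Z₁ x) S.reeb.contract₂₁ (S.smooth_Z₂ x) (smooth_extend v)
    simp only [S.reeb.contract₁₂, S.reeb.contract₂₂, zero_apply, mvfderiv_const,
      FiberBundle.extend_apply_self, add_zero] at h1 h2
    rw [← h1, ← h2, add_zero]
  rw [this, a1, a2]
  simp

/-- The almost complex structures `J` (for `ε = 1`) and `T` (for `ε = -1`). -/
noncomputable def complexStructure (S : AlmostContactPair E M p q) (ε : ℝ) (x : M) :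
    TangentSpace 𝓘(ℝ, E) x →L[ℝ] TangentSpace 𝓘(ℝ, E) x :=
  S.φ.toFun x + ε • ((S.α₁ x).smulRight (S.Z₂ x) - (S.α₂ x).smulRight (S.Z₁ x))

theorem complexStructure_apply (ε : ℝ) (v : TangentSpace 𝓘(ℝ, E) x) :
    S.complexStructure ε x v =
      S.φ.toFun x v + ε • (S.α₁ x v • S.Z₂ x - S.α₂ x v • S.Z₁ x) := by
  simp [complexStructure]

theorem isIntegrable_complexStructure (hN : S.IsNormal) {ε : ℝ} (hε : ε = 1 ∨ ε = -1) :
    IsIntegrable (S.complexStructure ε) := by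
  rcases hε with rfl | rfl
  · have : S.complexStructure 1 = S.J := by
      funext x; ext v; simp [complexStructure, J]; module
    exact this ▸ hN.1
  · have : S.complexStructure (-1) = S.T := by
      funext x; ext v; simp [complexStructure, T]; module
    exact this ▸ hN.2

theorem smooth_complexStructure (ε : ℝ) : IsSmoothEnd (S.complexStructure ε) := by
  intro x X hX
  have h : (fun y ↦ S.complexStructure ε y (X y)) = (fun y ↦ S.φ.toFun y (X y))
      + ((fun y ↦ ε * S.α₁ y (X y)) • S.Z₂ - (fun y ↦ ε * S.α₂ y (X y)) • S.Z₁) := by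
    funext y
    simp [complexStructure_apply]
    module
  refine smooth_congr ?_ h.eventuallyEq
  exact (S.φ.smooth_apply hX).add_section
    (((contMDiffAt_const.mul (S.α₁.smooth_apply hX)).smul_section (S.smooth_Z₂ x)).sub_section
      ((contMDiffAt_const.mul (S.α₂.smooth_apply hX)).smul_section (S.smooth_Z₁ x)))

theorem lie_complexStructure (hX : CMDiffAt ∞ (T% X) x) (ε : ℝ)
    (h1 : mlieBracket 𝓘(ℝ, E) Z S.Z₁ x = 0) (h2 : mlieBracket 𝓘(ℝ, E) Z S.Z₂ x = 0)
    (a1 : S.α₁ x (mlieBracket 𝓘(ℝ, E) Z X x) =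
      mvfderiv 𝓘(ℝ, E) (fun y ↦ S.α₁ y (X y)) x (Z x))
    (a2 : S.α₂ x (mlieBracket 𝓘(ℝ, E) Z X x) =
      mvfderiv 𝓘(ℝ, E) (fun y ↦ S.α₂ y (X y)) x (Z x)) :
    mlieBracket 𝓘(ℝ, E) Z (fun y ↦ S.complexStructure ε y (X y)) x =
      mlieBracket 𝓘(ℝ, E) Z (fun y ↦ S.φ.toFun y (X y)) x
        + (S.complexStructure ε x (mlieBracket 𝓘(ℝ, E) Z X x)
          - S.φ.toFun x (mlieBracket 𝓘(ℝ, E) Z X x)) := by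
  have s1 : CMDiffAt ∞ (fun y ↦ ε * S.α₁ y (X y)) x :=
    contMDiffAt_const.mul (S.α₁.smooth_apply hX)
  have s2 : CMDiffAt ∞ (fun y ↦ -ε * S.α₂ y (X y)) x :=
    contMDiffAt_const.mul (S.α₂.smooth_apply hX)
  have h : (fun y ↦ S.complexStructure ε y (X y)) = (fun y ↦ S.φ.toFun y (X y))
      + ((fun y ↦ ε * S.α₁ y (X y)) • S.Z₂ + (fun y ↦ -ε * S.α₂ y (X y)) • S.Z₁) := by
    funext y
    simp [complexStructure_apply]
    module
  have d1 := mvfderiv_mul (mdifferentiableAt_const (I := 𝓘(ℝ, E)) (x := x) (c := ε))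
    ((S.α₁.smooth_apply hX).mdifferentiableAt (by simp))
  have d2 := mvfderiv_mul (mdifferentiableAt_const (I := 𝓘(ℝ, E)) (x := x) (c := -ε))
    ((S.α₂.smooth_apply hX).mdifferentiableAt (by simp))
  simp only [Pi.mul_def, mvfderiv_const] at d1 d2
  rw [h, mlieBracket_add_right (mdiffAt_of_smooth (S.φ.smooth_apply hX))
      (mdiffAt_of_smooth ((s1.smul_section (S.smooth_Z₂ x)).add_section
        (s2.smul_section (S.smooth_Z₁ x)))),
    mlieBracket_add_right (mdiffAt_of_smooth (s1.smul_section (S.smooth_Z₂ x)))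
      (mdiffAt_of_smooth (s2.smul_section (S.smooth_Z₁ x))),
    mlieBracket_smul_right (s1.mdifferentiableAt (by simp)) (mdiffAt_of_smooth (S.smooth_Z₂ x)),
    mlieBracket_smul_right (s2.mdifferentiableAt (by simp)) (mdiffAt_of_smooth (S.smooth_Z₁ x)),
    h1, h2, d1, d2, complexStructure_apply, a1, a2]
  simp
  module

variable (hS : S.IsNormalMetricContactPair g)
include hS

/-- The vanishing of the Nijenhuis tensor of `complexStructure ε` on `Z₁` and `X`, rewritten in terms
of the defects `[Zᵢ, φ X] - φ [Zᵢ, X]`. Both signs of `ε` together force the defect of `Z₁` into the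
kernel of `φ`. -/
theorem φ_lie_defect (hX : CMDiffAt ∞ (T% X) x) {ε : ℝ} (hε : ε = 1 ∨ ε = -1) :
    S.φ.toFun x (mlieBracket 𝓘(ℝ, E) S.Z₁ (fun y ↦ S.φ.toFun y (X y)) x
      - S.φ.toFun x (mlieBracket 𝓘(ℝ, E) S.Z₁ X x)) =
    ε • (mlieBracket 𝓘(ℝ, E) S.Z₂ (fun y ↦ S.φ.toFun y (X y)) x
      - S.φ.toFun x (mlieBracket 𝓘(ℝ, E) S.Z₂ X x)) := by
  have hA := hS.associated
  have hN := isIntegrable_complexStructure hS.normal hε x S.Z₁ X (S.smooth_Z₁ x) hX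
  have hZ : (fun y ↦ S.complexStructure ε y (S.Z₁ y)) = ε • S.Z₂ := by
    funext y
    simp [complexStructure_apply, S.φ_Z₁, S.reeb.apply₁₁, S.reeb.apply₂₁]
  have hφX := S.φ.smooth_apply hX
  have z12 := lie_Z₁_Z₂ hA x
  have z21 : mlieBracket 𝓘(ℝ, E) S.Z₂ S.Z₁ x = 0 := lie_Z₁_Z₂ hS.swap.associated x
  have a11 := S.α₁.apply_lie (S.smooth_Z₁ x) S.reeb.apply₁₁ (S.reeb.contract₁₁ x) hX
  have a21 := S.α₂.apply_lie (S.smooth_Z₁ x) S.reeb.apply₂₁ (S.reeb.contract₂₁ x) hX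
  have a12 := S.α₁.apply_lie (S.smooth_Z₂ x) S.reeb.apply₁₂ (S.reeb.contract₁₂ x) hX
  have a22 := S.α₂.apply_lie (S.smooth_Z₂ x) S.reeb.apply₂₂ (S.reeb.contract₂₂ x) hX
  have e1 := lie_complexStructure hX ε (by simp) z12 a11 a21
  have e2 := lie_complexStructure hX ε z21 (by simp) a12 a22
  have b1 : S.α₁ x (mlieBracket 𝓘(ℝ, E) S.Z₁ (fun y ↦ S.φ.toFun y (X y)) x) = 0 := by
    rw [S.α₁.apply_lie (S.smooth_Z₁ x) S.reeb.apply₁₁ (S.reeb.contract₁₁ x) hφX]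
    simp [α₁_φ hA, mvfderiv_const]
  have b2 : S.α₂ x (mlieBracket 𝓘(ℝ, E) S.Z₁ (fun y ↦ S.φ.toFun y (X y)) x) = 0 := by
    rw [S.α₂.apply_lie (S.smooth_Z₁ x) S.reeb.apply₂₁ (S.reeb.contract₂₁ x) hφX]
    simp [α₂_φ hA, mvfderiv_const]
  rw [hZ, mlieBracket_const_smul_left (mdiffAt_of_smooth (S.smooth_Z₂ x)),
    mlieBracket_const_smul_left (mdiffAt_of_smooth (S.smooth_Z₂ x)), e1, e2] at hN
  simp only [complexStructure_apply, map_add, map_sub, map_smul, b1, b2,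
    α₁_φ hA, α₂_φ hA, S.φ_Z₁, S.φ_Z₂, S.φ_sq, S.reeb.apply₁₁, S.reeb.apply₁₂, S.reeb.apply₂₁,
    S.reeb.apply₂₂] at hN ⊢
  rw [← sub_eq_zero, ← hN]
  rcases hε with rfl | rfl <;> module

/-- Normality implies that `φ` is invariant under the Reeb vector fields. -/
theorem lie_Z₁_φ (hX : CMDiffAt ∞ (T% X) x) :
    mlieBracket 𝓘(ℝ, E) S.Z₁ (fun y ↦ S.φ.toFun y (X y)) x =
      S.φ.toFun x (mlieBracket 𝓘(ℝ, E) S.Z₁ X x) := by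
  have hA := hS.associated
  have hφX := S.φ.smooth_apply hX
  have h1 := φ_lie_defect hS hX (.inl rfl)
  have h2 := φ_lie_defect hS hX (.inr rfl)
  have b1 : S.α₁ x (mlieBracket 𝓘(ℝ, E) S.Z₁ (fun y ↦ S.φ.toFun y (X y)) x) = 0 := by
    rw [S.α₁.apply_lie (S.smooth_Z₁ x) S.reeb.apply₁₁ (S.reeb.contract₁₁ x) hφX]
    simp [α₁_φ hA, mvfderiv_const]
  have b2 : S.α₂ x (mlieBracket 𝓘(ℝ, E) S.Z₁ (fun y ↦ S.φ.toFun y (X y)) x) = 0 := by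
    rw [S.α₂.apply_lie (S.smooth_Z₁ x) S.reeb.apply₂₁ (S.reeb.contract₂₁ x) hφX]
    simp [α₂_φ hA, mvfderiv_const]
  set v := mlieBracket 𝓘(ℝ, E) S.Z₁ (fun y ↦ S.φ.toFun y (X y)) x
    - S.φ.toFun x (mlieBracket 𝓘(ℝ, E) S.Z₁ X x) with hv
  have h3 : S.φ.toFun x v = 0 := by
    have : (2 : ℝ) • S.φ.toFun x v = 0 := by
      rw [two_smul]
      nth_rewrite 1 [h1]
      rw [h2]
      module
    simpa using this
  have h4 := S.φ_sq x v
  have c1 : S.α₁ x v = 0 := by rw [hv, map_sub, b1, α₁_φ hA, sub_zero]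
  have c2 : S.α₂ x v = 0 := by rw [hv, map_sub, b2, α₂_φ hA, sub_zero]
  rw [h3, c1, c2] at h4
  simp only [map_zero, zero_smul, add_zero] at h4
  exact sub_eq_zero.1 (neg_eq_zero.1 h4.symm)

theorem killing_apply_φ (u v : TangentSpace 𝓘(ℝ, E) x) :
    g.inner x (leviCivita g S.Z₁ x u) (S.φ.toFun x v)
      + g.inner x u (leviCivita g S.Z₁ x (S.φ.toFun x v)) = 0 := by
  have h := lie_metric g (S.smooth_Z₁ x) (smooth_extend u) (S.φ.smooth_apply (smooth_extend v))
  have h1 := S.α₁.lie_d (S.smooth_Z₁ x) S.reeb.contract₁₁ (smooth_extend u) (smooth_extend v)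
  have h2 := S.α₂.lie_d (S.smooth_Z₁ x) S.reeb.contract₂₁ (smooth_extend u) (smooth_extend v)
  have h3 := mvfderiv_add (I := 𝓘(ℝ, E))
    ((S.α₁.smooth_d (smooth_extend u) (smooth_extend v)).mdifferentiableAt (by simp))
    ((S.α₂.smooth_d (smooth_extend u) (smooth_extend v)).mdifferentiableAt (by simp))
  simp only [Pi.add_def] at h3
  simp only [hS.associated.apply_φ, lie_Z₁_φ hS (smooth_extend v), h3, add_apply, h1, h2,
    FiberBundle.extend_apply_self] at h
  rw [hS.associated.apply_φ, h]
  ring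

theorem killing_apply_Z₁ (u : TangentSpace 𝓘(ℝ, E) x) :
    g.inner x (leviCivita g S.Z₁ x u) (S.Z₁ x)
      + g.inner x u (leviCivita g S.Z₁ x (S.Z₁ x)) = 0 := by
  have h := lie_metric g (S.smooth_Z₁ x) (smooth_extend u) (S.smooth_Z₁ x)
  simp only [hS.associated.apply_Z₁, mlieBracket_self,
    S.α₁.apply_lie (S.smooth_Z₁ x) S.reeb.apply₁₁ (S.reeb.contract₁₁ x) (smooth_extend u),
    FiberBundle.extend_apply_self, Pi.zero_apply, map_zero, sub_self] at h
  rw [hS.associated.apply_Z₁, h]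

theorem killing_apply_Z₂ (u : TangentSpace 𝓘(ℝ, E) x) :
    g.inner x (leviCivita g S.Z₁ x u) (S.Z₂ x)
      + g.inner x u (leviCivita g S.Z₁ x (S.Z₂ x)) = 0 := by
  have h := lie_metric g (S.smooth_Z₁ x) (smooth_extend u) (S.smooth_Z₂ x)
  simp only [hS.associated.apply_Z₂, lie_Z₁_Z₂ hS.associated,
    S.α₂.apply_lie (S.smooth_Z₁ x) S.reeb.apply₂₁ (S.reeb.contract₂₁ x) (smooth_extend u),
    FiberBundle.extend_apply_self, map_zero, sub_self] at h
  rw [hS.associated.apply_Z₂, h]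

/-- The Reeb vector field `Z₁` is Killing. -/
theorem killing (u v : TangentSpace 𝓘(ℝ, E) x) :
    g.inner x (leviCivita g S.Z₁ x u) v + g.inner x u (leviCivita g S.Z₁ x v) = 0 := by
  have h1 := killing_apply_φ hS u (S.φ.toFun x v)
  have h2 := killing_apply_Z₁ hS u
  have h3 := killing_apply_Z₂ hS u
  rw [S.φ_sq] at h1
  simp only [map_add, map_neg, map_smul, smul_eq_mul] at h1
  linear_combination -h1 + S.α₁ x v * h2 + S.α₂ x v * h3

/-- The covariant derivative of `Z₁` represents `dα₁`. -/
theorem inner_nabla_Z₁ (x : M) (u v : TangentSpace 𝓘(ℝ, E) x) :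
    g.inner x (leviCivita g S.Z₁ x u) v = S.α₁.d x u v := by
  have hk := killing hS u v
  obtain ⟨U, hU, rfl, nU⟩ := exists_normal_extension g u
  obtain ⟨V, hV, rfl, nV⟩ := exists_normal_extension g v
  rw [S.α₁.d_apply (mdiffAt_of_smooth hU) (mdiffAt_of_smooth hV)]
  simp only [← hS.associated.apply_Z₁]
  rw [mvfderiv_inner g _ hV (S.smooth_Z₁ x), mvfderiv_inner g _ hU (S.smooth_Z₁ x),
    mlieBracket_eq g hU hV, nabla, nabla, nU, nV, g.symm x (V x)]
  simp
  linarith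

theorem inner_nabla_Z₂ (x : M) (u v : TangentSpace 𝓘(ℝ, E) x) :
    g.inner x (leviCivita g S.Z₂ x u) v = S.α₂.d x u v :=
  inner_nabla_Z₁ hS.swap x u v

end AlmostContactPair

end Killing

/-! ### The covariant derivative of the structure tensor on horizontal vectors -/

section Horizontal

variable {E : Type*} [NormedAddCommGroup E] [NormedSpace ℝ E] [FiniteDimensional ℝ E]
  {M : Type*} [TopologicalSpace M] [ChartedSpace E M] [IsManifold 𝓘(ℝ, E) ∞ M]
  {x : M} {X Y Z : Π x : M, TangentSpace 𝓘(ℝ, E) x}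

namespace AlmostContactPair

variable {p q : ℕ} {S : AlmostContactPair E M p q} {g : Metric E M}

/-- The vector `u` lies in the horizontal bundle `ker α₁ ∩ ker α₂`. -/
def IsHorizontal (S : AlmostContactPair E M p q) {x : M} (u : TangentSpace 𝓘(ℝ, E) x) : Prop :=
  S.α₁ x u = 0 ∧ S.α₂ x u = 0

theorem isHorizontal_φ (hA : S.IsAssociated g) (u : TangentSpace 𝓘(ℝ, E) x) :
    S.IsHorizontal (S.φ.toFun x u) :=
  ⟨α₁_φ hA u, α₂_φ hA u⟩

theorem IsHorizontal.φ_φ {u : TangentSpace 𝓘(ℝ, E) x} (hu : S.IsHorizontal u) :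
    S.φ.toFun x (S.φ.toFun x u) = -u := by
  rw [S.φ_sq, hu.1, hu.2]
  simp

variable (S) in
theorem smooth_φ : IsSmoothEnd S.φ.toFun := fun _ _ hX ↦ S.φ.smooth_apply hX

variable (S g) in
theorem smooth_nabla_Z₁ : IsSmoothEnd (fun x ↦ leviCivita g S.Z₁ x) :=
  fun x _ hX ↦ smooth_nabla g hX (S.smooth_Z₁ x)

variable (hS : S.IsNormalMetricContactPair g)
include hS

theorem φ_eq (v : TangentSpace 𝓘(ℝ, E) x) :
    S.φ.toFun x v = -leviCivita g S.Z₁ x v - leviCivita g S.Z₂ x v := by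
  refine inner_ext g fun w ↦ ?_
  rw [inner_φ hS.associated, hS.associated.apply_φ, map_sub, map_neg, sub_apply,
    neg_apply, inner_nabla_Z₁ hS, inner_nabla_Z₂ hS]
  ring

theorem covEnd_φ_eq (u w : TangentSpace 𝓘(ℝ, E) x) :
    covEnd g S.smooth_φ x u w =
      -covEnd g (S.smooth_nabla_Z₁ g) x u w - covEnd g (S.swap.smooth_nabla_Z₁ g) x u w := by
  obtain ⟨U, hU, rfl, nU⟩ := exists_normal_extension g u
  have s1 : CMDiffAt ∞ (T% (fun y ↦ leviCivita g S.Z₁ y (U y))) x := S.smooth_nabla_Z₁ g hU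
  have s2 : CMDiffAt ∞ (T% (fun y ↦ leviCivita g S.Z₂ y (U y))) x := S.swap.smooth_nabla_Z₁ g hU
  rw [covEnd_apply g _ hU, covEnd_apply g _ hU, covEnd_apply g _ hU, nU]
  have h : (fun y ↦ S.φ.toFun y (U y)) =
      (-fun y ↦ leviCivita g S.Z₁ y (U y)) - fun y ↦ leviCivita g S.Z₂ y (U y) := by
    funext y
    exact φ_eq hS _
  rw [h, leviCivita_sub g s1.neg_section s2, leviCivita_neg g s1]
  simp [swap]

theorem covEnd_φ_skew (u v w : TangentSpace 𝓘(ℝ, E) x) :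
    g.inner x (covEnd g S.smooth_φ x u w) v = -g.inner x (covEnd g S.smooth_φ x v w) u := by
  rw [covEnd_skew g S.smooth_φ (fun _ ↦ inner_φ hS.associated) u v w, g.symm x u]

/-- `dα₁ + dα₂` is closed. -/
theorem covEnd_φ_cyclic (u v w : TangentSpace 𝓘(ℝ, E) x) :
    g.inner x (covEnd g S.smooth_φ x v u) w + g.inner x (covEnd g S.smooth_φ x w v) u
      + g.inner x (covEnd g S.smooth_φ x u w) v = 0 := by
  have h1 := covEnd_cyclic g (S.smooth_nabla_Z₁ g) S.α₁ (inner_nabla_Z₁ hS) u v w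
  have h2 := covEnd_cyclic g (S.swap.smooth_nabla_Z₁ g) S.swap.α₁ (inner_nabla_Z₁ hS.swap) u v w
  simp only [covEnd_φ_eq hS, map_sub, map_neg, sub_apply, neg_apply]
  linarith

omit hS in
theorem inner_covEnd_complexStructure (hA : S.IsAssociated g) {u v : TangentSpace 𝓘(ℝ, E) x}
    (hu : S.IsHorizontal u) (hv : S.IsHorizontal v) (w : TangentSpace 𝓘(ℝ, E) x) :
    g.inner x (covEnd g (S.smooth_complexStructure 1) x u w) v =
      g.inner x (covEnd g S.smooth_φ x u w) v := by
  obtain ⟨U, hU, rfl, nU⟩ := exists_normal_extension g u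
  have s1 := S.α₁.smooth_apply hU
  have s2 := S.α₂.smooth_apply hU
  rw [covEnd_apply g _ hU, covEnd_apply g _ hU, nU]
  have h : (fun y ↦ S.complexStructure 1 y (U y)) = (fun y ↦ S.φ.toFun y (U y))
      + ((fun y ↦ S.α₁ y (U y)) • S.Z₂ - (fun y ↦ S.α₂ y (U y)) • S.Z₁) := by
    funext y
    simp [complexStructure_apply]
  rw [h, leviCivita_add g (S.smooth_φ hU)
      ((s1.smul_section (S.smooth_Z₂ x)).sub_section (s2.smul_section (S.smooth_Z₁ x))),
    leviCivita_sub g (s1.smul_section (S.smooth_Z₂ x)) (s2.smul_section (S.smooth_Z₁ x)),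
    leviCivita_smul g s1 (S.smooth_Z₂ x), leviCivita_smul g s2 (S.smooth_Z₁ x), hu.1, hu.2]
  have z1 : g.inner x (S.Z₁ x) v = 0 := by rw [g.symm, hA.apply_Z₁, hv.1]
  have z2 : g.inner x (S.Z₂ x) v = 0 := by rw [g.symm, hA.apply_Z₂, hv.2]
  simp [z1, z2]

omit hS in
/-- Integrability of `J`, in terms of its covariant derivative. -/
theorem covEnd_complexStructure_integrable (hN : S.IsNormal) (u v : TangentSpace 𝓘(ℝ, E) x) :
    let K := S.complexStructure 1 x
    let D := covEnd g (S.smooth_complexStructure 1) x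
    K (D v u) - K (D u v) - D v (K u) + D u (K v) = 0 := by
  obtain ⟨U, hU, rfl, nU⟩ := exists_normal_extension g u
  obtain ⟨V, hV, rfl, nV⟩ := exists_normal_extension g v
  have hK := S.smooth_complexStructure 1
  have h := isIntegrable_complexStructure hN (.inl rfl) x U V hU hV
  rw [mlieBracket_eq g hU hV, mlieBracket_eq g (hK hU) hV, mlieBracket_eq g hU (hK hV),
    mlieBracket_eq g (hK hU) (hK hV)] at h
  simp only [nabla, nU, nV, zero_apply, sub_zero, zero_sub, map_neg] at h
  simp only [covEnd_apply g _ hU, covEnd_apply g _ hV, nU, nV, zero_apply, map_zero, sub_zero]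
  rw [← h]
  abel

/-- Horizontally, `φ` behaves like the complex structure of a Kähler manifold: it is integrable and
its fundamental form is closed, so it is parallel. -/
theorem inner_covEnd_φ_eq_zero {u v w : TangentSpace 𝓘(ℝ, E) x} (hu : S.IsHorizontal u)
    (hv : S.IsHorizontal v) (hw : S.IsHorizontal w) :
    g.inner x (covEnd g S.smooth_φ x u v) w = 0 := by
  have hA := hS.associated
  have key : ∀ {u v w : TangentSpace 𝓘(ℝ, E) x}, S.IsHorizontal u → S.IsHorizontal v →
      S.IsHorizontal w →
      g.inner x (covEnd g S.smooth_φ x u (S.φ.toFun x w)) v =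
        g.inner x (covEnd g S.smooth_φ x v (S.φ.toFun x u)) w
          + g.inner x (covEnd g S.smooth_φ x w (S.φ.toFun x v)) u := by
    intro u v w hu hv hw
    have hK : ∀ {z}, S.IsHorizontal z → S.complexStructure 1 x z = S.φ.toFun x z := fun hz ↦ by
      rw [complexStructure_apply, hz.1, hz.2]; simp
    have hKi : ∀ z, g.inner x (S.complexStructure 1 x z) w = -g.inner x z (S.φ.toFun x w) := by
      intro z
      have z1 : g.inner x (S.Z₁ x) w = 0 := by rw [g.symm, hA.apply_Z₁, hw.1]
      have z2 : g.inner x (S.Z₂ x) w = 0 := by rw [g.symm, hA.apply_Z₂, hw.2]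
      rw [complexStructure_apply, ← inner_φ hA]
      simp [z1, z2]
    have hφw := isHorizontal_φ hA w
    have h1 := congrArg (fun z ↦ g.inner x z w)
      (covEnd_complexStructure_integrable (g := g) hS.normal u v)
    simp only [map_sub, map_add, sub_apply, add_apply, hKi, hK hu, hK hv, map_zero, zero_apply,
      inner_covEnd_complexStructure hA hu hφw, inner_covEnd_complexStructure hA hv hφw,
      inner_covEnd_complexStructure hA hu hw, inner_covEnd_complexStructure hA hv hw] at h1
    have h2 := covEnd_φ_cyclic hS u v (S.φ.toFun x w)
    have h3 := covEnd_φ_skew hS (S.φ.toFun x w) u v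
    have h4 := covEnd_φ_skew hS v u (S.φ.toFun x w)
    have h5 := covEnd_φ_skew hS u w (S.φ.toFun x v)
    linarith
  have hv' := isHorizontal_φ hA v
  have k1 := key hu hw hv'
  have k2 := key hw hv' hu
  have k3 := key hv' hu hw
  have h := hv.φ_φ
  rw [h, map_neg, map_neg, neg_apply] at k1
  rw [h, map_neg, map_neg, neg_apply] at k2
  rw [h, map_neg, map_neg, neg_apply] at k3
  linarith

end AlmostContactPair

end Horizontal

/-! ### The Ricci curvature in the Reeb directions -/

section ReebRicci

variable {E : Type*} [NormedAddCommGroup E] [NormedSpace ℝ E] [FiniteDimensional ℝ E]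
  {M : Type*} [TopologicalSpace M] [ChartedSpace E M] [IsManifold 𝓘(ℝ, E) ∞ M]
  {x : M} {X Y Z : Π x : M, TangentSpace 𝓘(ℝ, E) x}

theorem IsSmoothEnd.comp {B C : Π x : M, TangentSpace 𝓘(ℝ, E) x →L[ℝ] TangentSpace 𝓘(ℝ, E) x}
    (hB : IsSmoothEnd B) (hC : IsSmoothEnd C) : IsSmoothEnd (fun x ↦ B x ∘L C x) :=
  fun _ _ hX ↦ hB (hC hX)

theorem covEnd_comp (g : Metric E M)
    {B C : Π x : M, TangentSpace 𝓘(ℝ, E) x →L[ℝ] TangentSpace 𝓘(ℝ, E) x}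
    (hB : IsSmoothEnd B) (hC : IsSmoothEnd C) (u w : TangentSpace 𝓘(ℝ, E) x) :
    covEnd g (hB.comp hC) x u w = covEnd g hB x (C x u) w + B x (covEnd g hC x u w) := by
  obtain ⟨U, hU, rfl, -⟩ := exists_normal_extension g u
  rw [covEnd_apply g _ hU, covEnd_apply g hB (hC hU), covEnd_apply g hC hU, map_sub]
  simp

theorem covEnd_congr (g : Metric E M)
    {B C : Π x : M, TangentSpace 𝓘(ℝ, E) x →L[ℝ] TangentSpace 𝓘(ℝ, E) x}
    (hB : IsSmoothEnd B) (hC : IsSmoothEnd C) (h : ∀ x v, B x v = C x v) :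
    covEnd g hB = covEnd g hC := by
  obtain rfl : B = C := by funext x; ext v; exact h x v
  rfl

/-- The derivative of a field of projections has trace zero. -/
theorem trace_covEnd_of_idem (g : Metric E M)
    {P : Π x : M, TangentSpace 𝓘(ℝ, E) x →L[ℝ] TangentSpace 𝓘(ℝ, E) x}
    (hP : IsSmoothEnd P) (h : ∀ x v, P x (P x v) = P x v) (w : TangentSpace 𝓘(ℝ, E) x) :
    LinearMap.trace ℝ _ ((covEnd g hP x).flip w) = 0 := by
  set L := (covEnd g hP x).flip w with hL
  set Q := (P x).toLinearMap
  have h1 : L ∘ₗ Q + Q ∘ₗ L = L := by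
    ext v
    have := covEnd_comp g hP hP v w
    rw [covEnd_congr g (hP.comp hP) hP (fun x v ↦ h x v)] at this
    exact this.symm
  have hQ : Q ∘ₗ Q = Q := by ext v; exact h x v
  have h2 : Q ∘ₗ L ∘ₗ Q = 0 := by
    have := congrArg (fun T ↦ Q ∘ₗ T) h1
    simp only [LinearMap.comp_add, ← LinearMap.comp_assoc, hQ] at this
    simpa [LinearMap.comp_assoc] using this
  have h3 : LinearMap.trace ℝ _ (Q ∘ₗ L) = 0 := by
    rw [← hQ, LinearMap.comp_assoc, LinearMap.trace_comp_comm', LinearMap.comp_assoc, h2, map_zero]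
  rw [← h1, map_add, LinearMap.trace_comp_comm', h3, add_zero]

namespace AlmostContactPair

variable {p q : ℕ} {S : AlmostContactPair E M p q} {g : Metric E M}

variable (hS : S.IsNormalMetricContactPair g)
include hS

omit hS in
/-- By cyclicity of the trace, `A = A P` gives `tr (K A) = tr (P K A)`, where `P` is the horizontal
projection. -/
theorem trace_comp_eq_zero (hA : S.IsAssociated g)
    {K A : TangentSpace 𝓘(ℝ, E) x →ₗ[ℝ] TangentSpace 𝓘(ℝ, E) x}
    (hK : ∀ v w, S.IsHorizontal v → S.IsHorizontal w → g.inner x (K v) w = 0)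
    (hAh : ∀ v, S.IsHorizontal (A v)) (h1 : A (S.Z₁ x) = 0) (h2 : A (S.Z₂ x) = 0) :
    LinearMap.trace ℝ _ (K ∘ₗ A) = 0 := by
  -- `-φ²` is the projection onto the horizontal part
  set P := -((S.φ.toFun x).toLinearMap ∘ₗ (S.φ.toFun x).toLinearMap) with hP
  have hPA : A ∘ₗ P = A := by
    ext v
    simp [hP, S.φ_sq, h1, h2]
  have hPK : P ∘ₗ K ∘ₗ A = 0 := by
    ext v
    refine inner_ext g fun w ↦ ?_
    have h3 : g.inner x (P (K (A v))) w = g.inner x (K (A v)) (P w) := by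
      simp only [hP, LinearMap.neg_apply, LinearMap.comp_apply, ContinuousLinearMap.coe_coe,
        map_neg, neg_apply, inner_φ hA]
      simp
    have h4 := hK (A v) (P w) (hAh v) (by
      simp only [hP, LinearMap.neg_apply, LinearMap.comp_apply, ContinuousLinearMap.coe_coe,
        ← map_neg]
      exact isHorizontal_φ hA _)
    simp only [LinearMap.comp_apply, h3, h4]
    simp
  rw [← hPA, ← LinearMap.comp_assoc, LinearMap.trace_comp_comm', hPK, map_zero]

omit hS in
/-- An endomorphism whose horizontal block vanishes has the trace of its Reeb block. -/
theorem trace_eq_vertical (hA : S.IsAssociated g)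
    {K : TangentSpace 𝓘(ℝ, E) x →ₗ[ℝ] TangentSpace 𝓘(ℝ, E) x}
    (hK : ∀ v w, S.IsHorizontal v → S.IsHorizontal w → g.inner x (K v) w = 0) :
    LinearMap.trace ℝ _ K = S.α₁ x (K (S.Z₁ x)) + S.α₂ x (K (S.Z₂ x)) := by
  set P := -((S.φ.toFun x).toLinearMap ∘ₗ (S.φ.toFun x).toLinearMap) with hP
  have h1 : K = K ∘ₗ P + (S.α₁ x).toLinearMap.smulRight (K (S.Z₁ x))
      + (S.α₂ x).toLinearMap.smulRight (K (S.Z₂ x)) := by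
    ext v
    simp [hP, S.φ_sq]
    abel
  have h2 : LinearMap.trace ℝ _ (K ∘ₗ P) = 0 := by
    refine trace_comp_eq_zero hA hK (fun v ↦ ?_) ?_ ?_
    · simp only [hP, LinearMap.neg_apply, LinearMap.comp_apply, ContinuousLinearMap.coe_coe,
        ← map_neg]
      exact isHorizontal_φ hA _
    · simp [hP, S.φ_Z₁]
    · simp [hP, S.φ_Z₂]
  conv_lhs => rw [h1]
  rw [map_add, map_add, h2, LinearMap.trace_smulRight, LinearMap.trace_smulRight]
  simp

theorem isHorizontal_nabla_Z₁ (v : TangentSpace 𝓘(ℝ, E) x) :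
    S.IsHorizontal (leviCivita g S.Z₁ x v) :=
  ⟨α₁_apply hS (inner_nabla_Z₁ hS x) v, α₂_apply hS (inner_nabla_Z₁ hS x) v⟩

/-- `Ric(u, Z₁)` is the trace of `w ↦ (∇_w ∇Z₁) u`. -/
theorem ricci_Z₁_eq_trace (u : TangentSpace 𝓘(ℝ, E) x) :
    ricci g x u (S.Z₁ x) = LinearMap.trace ℝ _ (covEnd g (S.smooth_nabla_Z₁ g) x u) := by
  set D := covEnd g (S.smooth_nabla_Z₁ g) x
  have h : riemEnd g x u (S.Z₁ x) = D u - D.flip u := by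
    ext w
    obtain ⟨U, hU, rfl, nU⟩ := exists_normal_extension g u
    obtain ⟨W, hW, rfl, nW⟩ := exists_normal_extension g w
    rw [riemEnd_apply, riem_apply g hW hU (S.smooth_Z₁ x)]
    have hb : mlieBracket 𝓘(ℝ, E) W U x = 0 := by
      rw [mlieBracket_eq g hW hU, nabla, nabla, nU, nW]; simp
    rw [LinearMap.sub_apply, LinearMap.flip_apply, covEnd_apply g _ hU, covEnd_apply g _ hW, nU, nW]
    simp only [curvature, Pi.sub_apply, zero_apply, map_zero, sub_zero]
    simp only [nabla, hb, map_zero, sub_zero]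
    rfl
  rw [ricci_eq_trace, h, map_sub, trace_eq_zero_of_skew g (B := D.flip u), sub_zero]
  intro v w
  have := covEnd_skew g (S.smooth_nabla_Z₁ g) (fun y ↦ inner_apply (inner_nabla_Z₁ hS y)) v w u
  exact this

theorem ricci_Z₁_Z₁ : ricci g x (S.Z₁ x) (S.Z₁ x) = 2 * p := by
  rw [ricci_Z₁_eq_trace hS, ← trace_φ_apply hS (inner_nabla_Z₁ hS x)]
  congr 1
  ext w
  have h0 : (fun y ↦ leviCivita g S.Z₁ y (S.Z₁ y)) = 0 := by
    funext y
    exact apply_Z₁ (inner_nabla_Z₁ hS y)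
  rw [covEnd_apply g _ (S.smooth_Z₁ x), h0, apply_apply hS (inner_nabla_Z₁ hS x)]
  simp

theorem ricci_Z₂_Z₁ : ricci g x (S.Z₂ x) (S.Z₁ x) = 0 := by
  rw [ricci_Z₁_eq_trace hS, ← map_zero (LinearMap.trace ℝ (TangentSpace 𝓘(ℝ, E) x))]
  congr 1
  ext w
  have h0 : (fun y ↦ leviCivita g S.Z₁ y (S.Z₂ y)) = 0 := by
    funext y
    exact apply_Z₂ (inner_nabla_Z₁ hS y)
  have h1 : leviCivita g S.Z₂ x w = -S.φ.toFun x w - leviCivita g S.Z₁ x w := by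
    rw [φ_eq hS]; abel
  rw [covEnd_apply g _ (S.smooth_Z₂ x), h0, h1, map_sub, map_neg,
    apply_apply hS (inner_nabla_Z₁ hS x), apply_φ_comm hS (inner_nabla_Z₁ hS x)]
  simp

/-- Up to terms in `∇_u φ`, whose trace vanishes, the endomorphism `φ ∘ ∇_u ∇Z₁` is the derivative of
the field of projections `φ ∘ ∇Z₁`. -/
theorem trace_φ_covEnd_flip {u : TangentSpace 𝓘(ℝ, E) x} (hu : S.IsHorizontal u) :
    LinearMap.trace ℝ _ ((S.φ.toFun x).toLinearMap ∘ₗ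
      (covEnd g (S.smooth_nabla_Z₁ g) x).flip u) = 0 := by
  have h1 := trace_covEnd_of_idem g (x := x) (S.smooth_φ.comp (S.smooth_nabla_Z₁ g))
    (fun y ↦ φ_apply_idem hS (inner_nabla_Z₁ hS y)) u
  have h2 : (covEnd g (S.smooth_φ.comp (S.smooth_nabla_Z₁ g)) x).flip u =
      (covEnd g S.smooth_φ x).flip u ∘ₗ (leviCivita g S.Z₁ x).toLinearMap
        + (S.φ.toFun x).toLinearMap ∘ₗ (covEnd g (S.smooth_nabla_Z₁ g) x).flip u := by
    ext v
    exact covEnd_comp g S.smooth_φ (S.smooth_nabla_Z₁ g) v u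
  have hK : ∀ v w, S.IsHorizontal v → S.IsHorizontal w →
      g.inner x ((covEnd g S.smooth_φ x).flip u v) w = 0 := fun v w hv hw ↦ by
    rw [LinearMap.flip_apply, inner_covEnd_φ_eq_zero hS hv hu hw]
  have z1 : leviCivita g S.Z₁ x (S.Z₁ x) = 0 := apply_Z₁ (inner_nabla_Z₁ hS x)
  have z2 : leviCivita g S.Z₁ x (S.Z₂ x) = 0 := apply_Z₂ (inner_nabla_Z₁ hS x)
  have h3 := trace_comp_eq_zero (A := (leviCivita g S.Z₁ x).toLinearMap) hS.associated hK
    (isHorizontal_nabla_Z₁ hS) z1 z2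
  rwa [h2, map_add, h3, zero_add] at h1

/-- Because `dα₁` is closed, the trace of `w ↦ φ ((∇_w ∇Z₁) u)` is half the trace of
`v ↦ φ ((∇_u ∇Z₁) v)`. -/
theorem trace_φ_covEnd {u : TangentSpace 𝓘(ℝ, E) x} (hu : S.IsHorizontal u) :
    LinearMap.trace ℝ _ ((S.φ.toFun x).toLinearMap ∘ₗ covEnd g (S.smooth_nabla_Z₁ g) x u) = 0 := by
  have hA := hS.associated
  have hr := fun x ↦ inner_nabla_Z₁ hS x
  have hskew : ∀ v w, g.inner x (covEnd g (S.smooth_nabla_Z₁ g) x v w) u =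
      -g.inner x (covEnd g (S.smooth_nabla_Z₁ g) x u w) v := fun v w ↦ by
    rw [covEnd_skew g (S.smooth_nabla_Z₁ g) (fun y ↦ inner_apply (hr y)) v u w, g.symm x v]
  have hcyc := covEnd_cyclic (x := x) g (S.smooth_nabla_Z₁ g) S.α₁ hr
  set D := covEnd g (S.smooth_nabla_Z₁ g) x
  set F := (S.φ.toFun x).toLinearMap with hF
  have h1 : LinearMap.trace ℝ _ (F ∘ₗ D u - F ∘ₗ D.flip u) =
      LinearMap.trace ℝ _ (-(D u ∘ₗ F)) := by
    refine trace_eq_of_adjoint g fun v w ↦ ?_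
    have c := hcyc u v (S.φ.toFun x w)
    rw [hskew (S.φ.toFun x w) v] at c
    simp only [hF, LinearMap.sub_apply, LinearMap.comp_apply, ContinuousLinearMap.coe_coe,
      LinearMap.flip_apply, LinearMap.neg_apply, map_sub, map_neg, sub_apply,
      inner_φ hA]
    rw [g.symm x v]
    linarith
  have h2 : LinearMap.trace ℝ _ (F ∘ₗ D.flip u) = 0 := trace_φ_covEnd_flip hS hu
  rw [map_sub, h2, map_neg] at h1
  have h3 := LinearMap.trace_comp_comm' (D u) F
  linarith

/-- Differentiating `φ ∘ ∇Z₁ = ∇Z₁ ∘ φ` expresses `(∇_w ∇Z₁) (φ u)` in terms of `φ ((∇_w ∇Z₁) u)` and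
of derivatives of `φ`, all of which have trace zero. -/
theorem ricci_φ_Z₁ {u : TangentSpace 𝓘(ℝ, E) x} (hu : S.IsHorizontal u) :
    ricci g x (S.φ.toFun x u) (S.Z₁ x) = 0 := by
  have hA := hS.associated
  have hr := fun x ↦ inner_nabla_Z₁ hS x
  set A := leviCivita g S.Z₁ x
  have h1 : covEnd g (S.smooth_nabla_Z₁ g) x (S.φ.toFun x u) =
      covEnd g S.smooth_φ x (A u)
        + (S.φ.toFun x).toLinearMap ∘ₗ covEnd g (S.smooth_nabla_Z₁ g) x u
        - A.toLinearMap ∘ₗ covEnd g S.smooth_φ x u := by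
    ext w
    have e1 := covEnd_comp g S.smooth_φ (S.smooth_nabla_Z₁ g) u w
    have e2 := covEnd_comp g (S.smooth_nabla_Z₁ g) S.smooth_φ u w
    rw [covEnd_congr g (S.smooth_φ.comp (S.smooth_nabla_Z₁ g))
      ((S.smooth_nabla_Z₁ g).comp S.smooth_φ) (fun y v ↦ (apply_φ_comm hS (hr y) v).symm), e2] at e1
    exact eq_sub_of_add_eq e1
  have h2 : LinearMap.trace ℝ _ (covEnd g S.smooth_φ x (A u)) = 0 := by
    have hv := trace_eq_vertical hA (K := covEnd g S.smooth_φ x (A u)) fun v w hv hw ↦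
      inner_covEnd_φ_eq_zero hS (isHorizontal_nabla_Z₁ hS u) hv hw
    have z1 : covEnd g S.smooth_φ x (S.Z₁ x) (S.Z₁ x) = 0 := by
      rw [covEnd_apply g _ (S.smooth_Z₁ x), apply_Z₁ (hr x), map_zero, sub_zero]
      simp [S.φ_Z₁, ← Pi.zero_def]
    have z2 : covEnd g S.smooth_φ x (S.Z₂ x) (S.Z₂ x) = 0 := by
      have : leviCivita g S.Z₂ x (S.Z₂ x) = 0 := apply_Z₁ (inner_nabla_Z₁ hS.swap x)
      rw [covEnd_apply g _ (S.smooth_Z₂ x), this, map_zero, sub_zero]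
      simp [S.φ_Z₂, ← Pi.zero_def]
    rw [hv, ← hA.apply_Z₁, ← hA.apply_Z₂, covEnd_φ_skew hS, z1, covEnd_φ_skew hS _ (S.Z₂ x), z2]
    simp
  have h3 : LinearMap.trace ℝ _ (A.toLinearMap ∘ₗ covEnd g S.smooth_φ x u) = 0 := by
    rw [LinearMap.trace_comp_comm']
    exact trace_comp_eq_zero hA (fun v w hv hw ↦ inner_covEnd_φ_eq_zero hS hu hv hw)
      (isHorizontal_nabla_Z₁ hS) (apply_Z₁ (hr x)) (apply_Z₂ (hr x))
  rw [ricci_Z₁_eq_trace hS, h1, map_sub, map_add, h2, h3, trace_φ_covEnd hS hu]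
  simp

theorem ricci_horizontal_Z₁ {u : TangentSpace 𝓘(ℝ, E) x} (hu : S.IsHorizontal u) :
    ricci g x u (S.Z₁ x) = 0 := by
  have h := ricci_φ_Z₁ hS (u := S.φ.toFun x (-u)) (isHorizontal_φ hS.associated _)
  rwa [map_neg, map_neg, hu.φ_φ, neg_neg] at h

/-! ### The Ricci tensor -/

omit hS in
theorem isHorizontal_horizontal (v : TangentSpace 𝓘(ℝ, E) x) :
    S.IsHorizontal (S.horizontal x v) := by
  constructor <;>
    simp [horizontal, S.reeb.apply₁₁, S.reeb.apply₁₂, S.reeb.apply₂₁, S.reeb.apply₂₂]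

theorem ricci_Z₁ (v : TangentSpace 𝓘(ℝ, E) x) :
    ricci g x v (S.Z₁ x) = 2 * p * S.α₁ x v := by
  have hv : v = S.horizontal x v + S.α₁ x v • S.Z₁ x + S.α₂ x v • S.Z₂ x := by
    rw [horizontal]; abel
  rw [ricci_symm]
  conv_lhs => rw [hv]
  rw [ricci_add_right, ricci_add_right, ricci_smul_right, ricci_smul_right, ricci_symm,
    ricci_horizontal_Z₁ hS (isHorizontal_horizontal v), ricci_Z₁_Z₁ hS, ricci_symm,
    ricci_Z₂_Z₁ hS]
  ring

theorem ricci_Z₂ (v : TangentSpace 𝓘(ℝ, E) x) :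
    ricci g x v (S.Z₂ x) = 2 * q * S.α₂ x v :=
  ricci_Z₁ hS.swap v

/-- The Ricci tensor is determined by its restriction to the horizontal bundle. -/
theorem ricci_eq (u v : TangentSpace 𝓘(ℝ, E) x) :
    ricci g x u v = ricci g x (S.horizontal x u) (S.horizontal x v)
      + 2 * p * (S.α₁ x u * S.α₁ x v) + 2 * q * (S.α₂ x u * S.α₂ x v) := by
  have split : ∀ a b : TangentSpace 𝓘(ℝ, E) x, ricci g x a b = ricci g x a (S.horizontal x b)
      + 2 * p * (S.α₁ x a * S.α₁ x b) + 2 * q * (S.α₂ x a * S.α₂ x b) := fun a b ↦ by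
    have hb : b = S.horizontal x b + S.α₁ x b • S.Z₁ x + S.α₂ x b • S.Z₂ x := by
      rw [horizontal]; abel
    conv_lhs => rw [hb]
    rw [ricci_add_right, ricci_add_right, ricci_smul_right, ricci_smul_right, ricci_Z₁ hS,
      ricci_Z₂ hS]
    ring
  have hv := isHorizontal_horizontal (S := S) v
  rw [split u v, ricci_symm g u, split (S.horizontal x v) u, hv.1, hv.2, ricci_symm]
  ring

omit hS in
theorem inner_horizontal (hA : S.IsAssociated g) (u v : TangentSpace 𝓘(ℝ, E) x) :
    g.inner x (S.horizontal x u) (S.horizontal x v) =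
      g.inner x u v - S.α₁ x u * S.α₁ x v - S.α₂ x u * S.α₂ x v := by
  have hu := isHorizontal_horizontal (S := S) u
  conv_lhs => rw [horizontal.eq_1 S x v]
  simp only [map_sub, map_smul, hA.apply_Z₁, hA.apply_Z₂, hu.1, hu.2]
  simp only [horizontal, map_sub, map_smul, sub_apply, smul_apply, smul_eq_mul,
    g.symm x (S.Z₁ x), g.symm x (S.Z₂ x), hA.apply_Z₁, hA.apply_Z₂]
  ring

theorem ricciForm_of_horizontalRicciForm {lam : M → ℝ} (h : S.HorizontalRicciForm g lam) :
    S.RicciForm g lam (fun x ↦ 2 * p - lam x) (fun x ↦ 2 * q - lam x) := by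
  intro x u v
  rw [ricci_eq hS, h, inner_horizontal hS.associated]
  ring

omit hS in
theorem RicciForm.horizontal {lam β μ : M → ℝ} (h : S.RicciForm g lam β μ) :
    S.HorizontalRicciForm g lam := by
  intro x u v
  rw [h, (isHorizontal_horizontal u).1, (isHorizontal_horizontal u).2]
  ring

end AlmostContactPair

end ReebRicci

end ContactPair

theorem proposition3
    {E : Type*} [NormedAddCommGroup E] [NormedSpace ℝ E] [FiniteDimensional ℝ E]
    {M : Type*} [TopologicalSpace M] [ChartedSpace E M] [IsManifold 𝓘(ℝ, E) ∞ M]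
    {p q : ℕ} (S : ContactPair.AlmostContactPair E M p q) (g : ContactPair.Metric E M)
    (hS : S.IsNormalMetricContactPair g) :
    (S.IsGeneralizedQuasiEinstein g ↔ S.IsHorizontalEinstein g) ∧
      ∀ lam : M → ℝ, S.HorizontalRicciForm g lam →
        ∀ (x : M) (u v : TangentSpace 𝓘(ℝ, E) x),
          ContactPair.ricci g x u v = lam x * g.inner x u v
            + (2 * (p : ℝ) - lam x) * (S.α₁ x u * S.α₁ x v)
            + (2 * (q : ℝ) - lam x) * (S.α₂ x u * S.α₂ x v) := by
  refine ⟨⟨?_, ?_⟩, fun lam h ↦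
    ContactPair.AlmostContactPair.ricciForm_of_horizontalRicciForm hS h⟩
  · rintro ⟨lam, β, μ, hlam, -, -, h⟩
    exact ⟨lam, hlam, h.horizontal⟩
  · rintro ⟨lam, hlam, h⟩
    exact ⟨lam, _, _, hlam, contMDiff_const.sub hlam, contMDiff_const.sub hlam,
      ContactPair.AlmostContactPair.ricciForm_of_horizontalRicciForm hS h⟩
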